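/- All rings are commutative with $1$. For $n\in\mathbb Z_{\ge 0}$ let $\mathfrak B_n$ be the moduli scheme of based rank-$n$ algebras: the affine $\mathbb Z$-scheme with coordinates $c_{ij}^{\ell}, d_i$ ($1\le i,j,\ell\le n$), cut out by the polynomial equations saying that $e_ie_j=\sum_\ell c_{ij}^\ell e_\ell$ defines a commutative, associative multiplication on the free module with basis $e_1,\dots,e_n$, having $\sum_i d_ie_i$ as multiplicative identity. Let $\mathfrak B_n^1\subseteq\mathfrak B_n$ be the closed subscheme where $e_1$ is the identity ($d_1=1$ and $d_i=0$ for $i\ge2$; for $n=0$, $\mathfrak B_0^1=\mathfrak B_0$). For a field $k$ let $\mathfrak B_{n,k}$, $\mathfrak B^1_{n,k}$ be their base changes to $k$. Let $\bullet\in\mathfrak B^1_{n,k}(k)$ be the point given by the square-zero algebra $k[x_1,\dots,x_{n-1}]/(x_1,\dots,x_{n-1})^2$ with basis $1,x_1,\dots,x_{n-1}$. Let $\mathfrak B^{1,\mathrm{et}}_{n,k}\subseteq\mathfrak B^1_{n,k}$ be the open subscheme where the discriminant $\det(\operatorname{Tr}(e_ie_j))$ does not vanish. Let $k$ be a field. (a)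 For every $n\ge 0$ the following are equivalent: (i) $n\le 3$; (ii) $\mathfrak B^1_{n,k}$ is smooth over $k$; (iii) $\mathfrak B_{n,k}$ is smooth over $k$. (b) As schemes over $\mathbb Z$, $\mathfrak B^1_0\cong\mathbb A^0$, $\mathfrak B^1_1\cong\mathbb A^0$, $\mathfrak B^1_2\cong\mathbb A^2$ and $\mathfrak B^1_3\cong\mathbb A^6$. (c) For every $n\ge 4$, the Zariski tangent space $T_\bullet(\mathfrak B^1_{n,k})$ has dimension $n(n-1)^2/2$. The Zariski closure of $\mathfrak B^{1,\mathrm{et}}_{n,k}$ in $\mathfrak B^1_{n,k}$ is an irreducible component of $\mathfrak B^1_{n,k}$ that contains $\bullet$ and has dimension $n(n-1)$, and $n(n-1)<n(n-1)^2/2$. -/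

import Mathlib

open CategoryTheory AlgebraicGeometry TensorProduct

universe u

namespace ModuliAlg

/-- A based rank-`n` commutative algebra over `R`, given as a multiplication on the free module
`Rⁿ` with standard basis `e i` (the first basis vector has index `0`):
`e i * e j = ∑ l, c i j l • e l`, with multiplicative identity `∑ i, d i • e i`.
Every pair `(A, φ)` of a commutative `R`-algebra `A` and an `R`-linear isomorphism `φ : A ≃ Rⁿ`
is, up to the unique isomorphism of such pairs, of this form. -/
@[ext]
structure BasedAlg (n : ℕ) (R : Type*) [CommRing R] where
  c : Fin n → Fin n → Fin n → R
  d : Fin n → R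
  comm : ∀ i j l, c i j l = c j i l
  assoc : ∀ i j l p, ∑ m, c i j m * c m l p = ∑ m, c j l m * c i m p
  one_mul : ∀ j l, ∑ i, d i * c i j l = if j = l then 1 else 0

/-- The discriminant `det (Tr (e i * e j))`, where `Tr x` is the trace of multiplication by `x`. -/
noncomputable def BasedAlg.disc {n : ℕ} {R : Type*} [CommRing R] (A : BasedAlg n R) : R :=
  Matrix.det (Matrix.of fun i j => ∑ l, A.c i j l * ∑ m, A.c l m m)

/-- The square-zero algebra `R[x₁, …, xₙ₋₁] / (x₁, …, xₙ₋₁)²` with basis `1, x₁, …, xₙ₋₁`. -/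
def BasedAlg.squareZero (n : ℕ) (R : Type*) [CommRing R] : BasedAlg n R where
  c i j l := if i.val = 0 then (if j = l then 1 else 0)
    else if j.val = 0 then (if i = l then 1 else 0) else 0
  d i := if i.val = 0 then 1 else 0
  comm i j l := by
    by_cases hi : i.val = 0 <;> by_cases hj : j.val = 0 <;> simp [hi, hj]
    have : i = j := Fin.ext (hi.trans hj.symm)
    simp [this]
  assoc i j l p := by
    by_cases hi : i.val = 0
    · simp only [hi, if_true, mul_ite, mul_one, mul_zero]
      rw [Finset.sum_eq_single j, Finset.sum_ite_eq']
      · simp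
      · intro b _ hb
        simp [hb.symm]
      · simp
    · by_cases hj : j.val = 0
      · simp only [hi, hj, if_true, if_false, ite_mul, _root_.one_mul, zero_mul,
          Finset.sum_ite_eq, Finset.mem_univ]
      · by_cases hl : l.val = 0
        · simp only [hi, hj, hl, if_true, if_false, ite_mul, _root_.one_mul, zero_mul,
            Finset.sum_ite_eq, Finset.mem_univ, Finset.sum_const_zero]
        · simp only [hi, hj, hl, if_false, zero_mul]
  one_mul j l := by
    have h0 : 0 < n := j.pos
    rw [Finset.sum_eq_single (⟨0, h0⟩ : Fin n)]
    · simp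
    · intro b _ hb
      have : b.val ≠ 0 := fun h => hb (Fin.ext h)
      simp [this]
    · simp

theorem BasedAlg.squareZero_d (n : ℕ) (R : Type*) [CommRing R] (i : Fin n) :
    (BasedAlg.squareZero n R).d i = if i.val = 0 then 1 else 0 := rfl

/-- Index set of the indeterminates `c i j l` and `d i`. -/
abbrev Var (n : ℕ) : Type := (Fin n × Fin n × Fin n) ⊕ Fin n

/-- The indeterminate `c i j l`. -/
noncomputable def varC {n : ℕ} (i j l : Fin n) : MvPolynomial (Var n) ℤ :=
  MvPolynomial.X (Sum.inl (i, j, l))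

/-- The indeterminate `d i`. -/
noncomputable def varD {n : ℕ} (i : Fin n) : MvPolynomial (Var n) ℤ :=
  MvPolynomial.X (Sum.inr i)

/-- The polynomials expressing that the multiplication is commutative, associative and has
`∑ i, d i • e i` as an identity. -/
def relations (n : ℕ) : Set (MvPolynomial (Var n) ℤ) :=
  {f | ∃ i j l, f = varC i j l - varC j i l} ∪
  {f | ∃ i j l p, f = ∑ m, varC i j m * varC m l p - ∑ m, varC j l m * varC i m p} ∪
  {f | ∃ j l, f = ∑ i, varD i * varC i j l - if j = l then 1 else 0}

/-- The coordinate ring of the moduli scheme of based rank-`n` algebras. -/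
abbrev CoordRing (n : ℕ) : Type := MvPolynomial (Var n) ℤ ⧸ Ideal.span (relations n)

/-- The universal based algebra. -/
noncomputable def univ (n : ℕ) : BasedAlg n (CoordRing n) where
  c i j l := Ideal.Quotient.mk _ (varC i j l)
  d i := Ideal.Quotient.mk _ (varD i)
  comm i j l := by
    refine Ideal.Quotient.eq.2 (Ideal.subset_span ?_)
    exact Or.inl (Or.inl ⟨i, j, l, rfl⟩)
  assoc i j l p := by
    simp only [← map_mul, ← map_sum]
    refine Ideal.Quotient.eq.2 (Ideal.subset_span ?_)
    exact Or.inl (Or.inr ⟨i, j, l, p, rfl⟩)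
  one_mul j l := by
    have h : (if j = l then (1 : CoordRing n) else 0) =
        Ideal.Quotient.mk (Ideal.span (relations n)) (if j = l then 1 else 0) := by
      split_ifs <;> simp
    simp only [h, ← map_mul, ← map_sum]
    refine Ideal.Quotient.eq.2 (Ideal.subset_span ?_)
    exact Or.inr ⟨j, l, rfl⟩

/-- The based algebra obtained by extension of scalars. -/
def BasedAlg.map {n : ℕ} {R S : Type*} [CommRing R] [CommRing S] (f : R →+* S)
    (A : BasedAlg n R) : BasedAlg n S where
  c i j l := f (A.c i j l)
  d i := f (A.d i)
  comm i j l := by rw [A.comm]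
  assoc i j l p := by simp only [← map_mul, ← map_sum, A.assoc i j l p]
  one_mul j l := by
    simp only [← map_mul, ← map_sum, A.one_mul j l]
    split_ifs <;> simp

/-- The defining polynomials, together with those expressing that the first basis vector is `1`,
i.e. that `d 0 = 1` and `d i = 0` for `i ≠ 0` (no condition if `n = 0`). -/
def relations1 (n : ℕ) : Set (MvPolynomial (Var n) ℤ) :=
  relations n ∪ {f | ∃ i : Fin n, f = varD i - if i.val = 0 then 1 else 0}

/-- The coordinate ring of the closed subscheme where the first basis vector is `1`. -/
abbrev CoordRing1 (n : ℕ) : Type := MvPolynomial (Var n) ℤ ⧸ Ideal.span (relations1 n)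

/-- The restriction of functions to the closed subscheme where the first basis vector is `1`. -/
noncomputable def restrict1 (n : ℕ) : CoordRing n →+* CoordRing1 n :=
  Ideal.Quotient.factor (Ideal.span_mono Set.subset_union_left)

/-- Evaluation of polynomials at the constants of a based algebra. -/
noncomputable def BasedAlg.evalHom {n : ℕ} {R : Type*} [CommRing R] (A : BasedAlg n R) :
    MvPolynomial (Var n) ℤ →+* R :=
  MvPolynomial.eval₂Hom (Int.castRingHom R) (Sum.elim (fun x => A.c x.1 x.2.1 x.2.2) A.d)

theorem BasedAlg.evalHom_relations {n : ℕ} {R : Type*} [CommRing R] (A : BasedAlg n R)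
    {f : MvPolynomial (Var n) ℤ} (hf : f ∈ relations n) : A.evalHom f = 0 := by
  rcases hf with (⟨i, j, l, rfl⟩ | ⟨i, j, l, p, rfl⟩) | ⟨j, l, rfl⟩
  · simp [varC, A.comm i j l, evalHom]
  · simp [varC, A.assoc i j l p, evalHom]
  · have := A.one_mul j l
    by_cases h : j = l <;> simp_all [varC, varD, evalHom]

/-- The classifying map of a based algebra. -/
noncomputable def BasedAlg.classify {n : ℕ} {R : Type*} [CommRing R] (A : BasedAlg n R) :
    CoordRing n →+* R :=
  Ideal.Quotient.lift _ A.evalHom fun a ha => by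
    have h : Ideal.span (relations n) ≤ RingHom.ker A.evalHom :=
      Ideal.span_le.2 fun f hf => A.evalHom_relations hf
    exact h ha

/-- The classifying map of a based algebra whose first basis vector is `1`. -/
noncomputable def BasedAlg.classify1 {n : ℕ} {R : Type*} [CommRing R] (A : BasedAlg n R)
    (h1 : ∀ i : Fin n, A.d i = if i.val = 0 then 1 else 0) : CoordRing1 n →+* R :=
  Ideal.Quotient.lift _ A.evalHom fun a ha => by
    have h : Ideal.span (relations1 n) ≤ RingHom.ker A.evalHom := by
      refine Ideal.span_le.2 ?_
      rintro f (hf | ⟨i, rfl⟩)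
      · exact A.evalHom_relations hf
      · have := h1 i
        by_cases hi : i.val = 0 <;> simp_all [varD, BasedAlg.evalHom]
    exact h ha

/-- The `R`-points of `Spec (CoordRing n)` are the based rank-`n` algebras over `R`. -/
noncomputable def pointsEquiv (n : ℕ) (R : Type*) [CommRing R] :
    BasedAlg n R ≃ (CoordRing n →+* R) where
  toFun A := A.classify
  invFun f := (univ n).map f
  left_inv A := by
    ext <;> simp [BasedAlg.classify, BasedAlg.evalHom, BasedAlg.map, univ, varC, varD]
  right_inv f := by
    refine Ideal.Quotient.ringHom_ext (MvPolynomial.ringHom_ext (by simp) ?_)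
    rintro (⟨i, j, l⟩ | i) <;>
      simp [BasedAlg.classify, BasedAlg.evalHom, BasedAlg.map, univ, varC, varD]

/-- `B n`, the moduli scheme of based rank-`n` algebras. -/
noncomputable def B (n : ℕ) : Scheme.{0} := Spec (.of (CoordRing n))

/-- `B1 n`, the closed subscheme of `B n` where the first basis vector equals `1`. -/
noncomputable def B1 (n : ℕ) : Scheme.{0} := Spec (.of (CoordRing1 n))

section Field

variable (n : ℕ) (k : Type u) [Field k]

/-- The base change of `B n` to `k`. -/
noncomputable def Bk : Scheme.{u} := Spec (.of (k ⊗[ℤ] CoordRing n))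

/-- The base change of `B1 n` to `k`. -/
noncomputable def B1k : Scheme.{u} := Spec (.of (k ⊗[ℤ] CoordRing1 n))

/-- The structure morphism of the base change of `B n` to `k`. -/
noncomputable def BkStr : Bk n k ⟶ Spec (.of k) :=
  Spec.map (CommRingCat.ofHom (algebraMap k (k ⊗[ℤ] CoordRing n)))

/-- The structure morphism of the base change of `B1 n` to `k`. -/
noncomputable def B1kStr : B1k n k ⟶ Spec (.of k) :=
  Spec.map (CommRingCat.ofHom (algebraMap k (k ⊗[ℤ] CoordRing1 n)))

/-- The homomorphism of `k`-algebras classifying the square-zero algebra. -/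
noncomputable def bulletHom : k ⊗[ℤ] CoordRing1 n →ₐ[k] k :=
  Algebra.TensorProduct.lift (AlgHom.id k k)
    ((BasedAlg.squareZero n k).classify1 (BasedAlg.squareZero_d n k)).toIntAlgHom
    fun _ _ => Commute.all _ _

/-- The `k`-rational point of `B1 n` over `k` given by the square-zero algebra. -/
noncomputable def bulletMap : Spec (.of k) ⟶ B1k n k :=
  Spec.map (CommRingCat.ofHom (bulletHom n k).toRingHom)

/-- The point of the underlying space of `B1k n k` given by the square-zero algebra. -/
noncomputable def bullet : B1k n k := bulletMap n k (IsLocalRing.closedPoint k)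

/-- The étale locus of `B1 n` over `k`, the open set where the discriminant does not vanish. -/
def etaleLocus : Set (B1k n k) :=
  {x : PrimeSpectrum (k ⊗[ℤ] CoordRing1 n) |
    (1 : k) ⊗ₜ[ℤ] restrict1 n (univ n).disc ∉ x.asIdeal}

end Field

/-- The Zariski tangent space `(𝔪 / 𝔪²)*` of a scheme at a point. -/
abbrev TangentSpace (X : Scheme.{u}) (x : X) : Type u :=
  Module.Dual (IsLocalRing.ResidueField (X.presheaf.stalk x))
    (IsLocalRing.CotangentSpace (X.presheaf.stalk x))

end ModuliAlg

/-! Everything is read off from functors of points: maps out of the coordinate rings are based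
algebras, and algebra structures, lifts and degenerations are written down directly.

For `n ≤ 3` a unital algebra is freely determined by a few structure constants. The case `n = 3` is
the only one with content: associativity determines the three constant terms and imposes nothing
further (`IsUnital.eq_cubic`). So `B1 n` is an affine space. Smoothness passes to `B n` because,
where some `d i` is invertible, a change of basis moves the identity to the first basis vector and
commutes with lifting along square-zero extensions (`exists_lift`, `formallySmooth_away`).

For `n ≥ 4` the square-zero algebra has the first order deformation `x₁² = εx₂`, `x₂² = εx₃`. It
does not lift from `ε² = 0` to `ε³ = 0`: in `(x₁x₁)x₂ = x₁(x₁x₂)` the coefficient of `x₃` would be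
`ε²` on the left and `0` on the right (`sq_eq_zero_of_map_eq_deform`). Neither scheme is therefore
formally smooth.

Near the square-zero algebra the constants with all indices nonzero are free to first order, while
the coefficients of the identity vanish to second order. Counting the former gives the tangent
dimension `finrank_tangentSpace_bullet`.

Over an algebraically closed field an algebra of nonzero discriminant is `Kⁿ` with a basis, that is,
an invertible matrix whose first column is `1`. The generic such matrix gives one generic point of
the étale locus (`IsUniversal.ker_le`), so the closure is irreducible, and it is a component because
the locus is open. Scaling the nonidentity basis vectors by `X` and letting `X → 0` degenerates an
étale algebra to the square-zero one (`IsUniversal.exists_le_ker`). The entries of the generic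
matrix are eigenvalues of multiplication operators, hence algebraic over the structure constants;
the dimension is thus the number `n(n-1)` of free entries (`trdeg_eq_of_genUnit`). -/

namespace ModuliAlg

open Matrix

/-! ### Multiplication as a bilinear map, base change and change of basis -/

namespace BasedAlg

variable {n : ℕ} {R S T : Type*} [CommRing R] [CommRing S] [CommRing T]

/-- The multiplication of a based algebra, as a bilinear map on the free module. -/
def mul (A : BasedAlg n R) : (Fin n → R) →ₗ[R] (Fin n → R) →ₗ[R] (Fin n → R) :=
  LinearMap.mk₂ R (fun x y l => ∑ i, ∑ j, x i * y j * A.c i j l)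
    (fun x x' y => by ext l; simp [add_mul, Finset.sum_add_distrib])
    (fun a x y => by ext l; simp [mul_assoc, Finset.mul_sum])
    (fun x y y' => by ext l; simp [mul_add, add_mul, Finset.sum_add_distrib])
    (fun a x y => by ext l; simp [mul_assoc, mul_left_comm, Finset.mul_sum])

theorem mul_apply (A : BasedAlg n R) (x y : Fin n → R) (l : Fin n) :
    A.mul x y l = ∑ i, ∑ j, x i * y j * A.c i j l := rfl

@[simp]
theorem mul_single (A : BasedAlg n R) (i j : Fin n) :
    A.mul (Pi.single i 1) (Pi.single j 1) = A.c i j := by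
  ext l
  rw [mul_apply, Finset.sum_eq_single i, Finset.sum_eq_single j] <;> simp +contextual

theorem mul_comm (A : BasedAlg n R) (x y : Fin n → R) : A.mul x y = A.mul y x := by
  ext l
  simp only [mul_apply]
  rw [Finset.sum_comm]
  refine Finset.sum_congr rfl fun i _ => Finset.sum_congr rfl fun j _ => ?_
  rw [A.comm, _root_.mul_comm (x j)]

theorem mul_single_right_apply (A : BasedAlg n R) (x : Fin n → R) (j l : Fin n) :
    A.mul x (Pi.single j 1) l = ∑ i, x i * A.c i j l := by
  rw [mul_apply]
  refine Finset.sum_congr rfl fun i _ => ?_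
  rw [Finset.sum_eq_single j] <;> simp +contextual

theorem mul_single_left_apply (A : BasedAlg n R) (x : Fin n → R) (j l : Fin n) :
    A.mul (Pi.single j 1) x l = ∑ i, x i * A.c j i l := by
  rw [mul_comm, mul_single_right_apply]
  exact Finset.sum_congr rfl fun i _ => by rw [A.comm]

/-- Both sides are trilinear, so the identity spreads from basis vectors one argument at a time,
starting with the last. -/
theorem mul_assoc (A : BasedAlg n R) (x y z : Fin n → R) :
    A.mul (A.mul x y) z = A.mul x (A.mul y z) := by
  have hz (i j : Fin n) (z : Fin n → R) :
      A.mul (A.mul (Pi.single i 1) (Pi.single j 1)) z =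
        A.mul (Pi.single i 1) (A.mul (Pi.single j 1) z) := by
    have : A.mul (A.mul (Pi.single i 1) (Pi.single j 1)) =
        (A.mul (Pi.single i 1)).comp (A.mul (Pi.single j 1)) := by
      refine (Pi.basisFun R (Fin n)).ext fun l => ?_
      ext p
      simp only [Pi.basisFun_apply, LinearMap.comp_apply, mul_single, mul_single_right_apply,
        mul_single_left_apply]
      exact A.assoc i j l p
    exact LinearMap.congr_fun this z
  have hy (i : Fin n) (y z : Fin n → R) :
      A.mul (A.mul (Pi.single i 1) y) z = A.mul (Pi.single i 1) (A.mul y z) := by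
    have : (A.mul.flip z).comp (A.mul (Pi.single i 1)) =
        (A.mul (Pi.single i 1)).comp (A.mul.flip z) :=
      (Pi.basisFun R (Fin n)).ext fun j => by simpa using hz i j z
    exact LinearMap.congr_fun this y
  have : (A.mul.flip z).comp (A.mul.flip y) = A.mul.flip (A.mul y z) :=
    (Pi.basisFun R (Fin n)).ext fun i => by simpa using hy i y z
  exact LinearMap.congr_fun this x

theorem d_mul (A : BasedAlg n R) (x : Fin n → R) : A.mul A.d x = x := by
  have : A.mul A.d = LinearMap.id := by
    refine (Pi.basisFun R (Fin n)).ext fun j => ?_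
    ext l
    rw [Pi.basisFun_apply, mul_single_right_apply, A.one_mul j l, LinearMap.id_apply,
      Pi.single_apply]
    simp [eq_comm]
  exact LinearMap.congr_fun this x

theorem mul_d (A : BasedAlg n R) (x : Fin n → R) : A.mul x A.d = x := by
  rw [mul_comm, d_mul]

theorem bilin_eq_sum (β : (Fin n → R) →ₗ[R] (Fin n → R) →ₗ[R] (Fin n → R)) (x z : Fin n → R) :
    β x z = ∑ m, x m • β (Pi.single m 1) z := by
  conv_lhs => rw [pi_eq_sum_univ' x, map_sum, LinearMap.sum_apply]
  simp

/-- A based algebra from a commutative, associative and unital bilinear multiplication. -/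
def ofMul (β : (Fin n → R) →ₗ[R] (Fin n → R) →ₗ[R] (Fin n → R)) (d : Fin n → R)
    (hc : ∀ x y, β x y = β y x) (ha : ∀ x y z, β (β x y) z = β x (β y z))
    (h1 : ∀ x, β d x = x) : BasedAlg n R where
  c i j l := β (Pi.single i 1) (Pi.single j 1) l
  d := d
  comm i j l := by rw [hc]
  assoc i j l p := by
    have := congrFun (ha (Pi.single i 1) (Pi.single j 1) (Pi.single l 1)) p
    rw [bilin_eq_sum β (β _ _), hc (Pi.single i 1) (β _ _), bilin_eq_sum β (β _ _)] at this
    simpa [hc _ (Pi.single i 1)] using this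
  one_mul j l := by
    have := congrFun (h1 (Pi.single j 1)) l
    rw [bilin_eq_sum] at this
    simpa [Pi.single_apply, eq_comm] using this

@[simp]
theorem mul_ofMul (β : (Fin n → R) →ₗ[R] (Fin n → R) →ₗ[R] (Fin n → R)) (d : Fin n → R)
    (hc ha h1) : (ofMul β d hc ha h1).mul = β := by
  refine (Pi.basisFun R (Fin n)).ext fun i => (Pi.basisFun R (Fin n)).ext fun j => ?_
  simp only [Pi.basisFun_apply, mul_single]
  rfl

theorem ext_mul {A B : BasedAlg n R} (h : A.mul = B.mul) (hd : A.d = B.d) : A = B := by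
  ext i j l
  · rw [← mul_single, ← mul_single, h]
  · rw [hd]

theorem map_mul (f : R →+* S) (A : BasedAlg n R) (x y : Fin n → R) :
    (A.map f).mul (f ∘ x) (f ∘ y) = f ∘ A.mul x y := by
  ext l
  simp [mul_apply, map]

theorem map_map (f : R →+* S) (g : S →+* T) (A : BasedAlg n R) :
    (A.map f).map g = A.map (g.comp f) := rfl

theorem map_id (A : BasedAlg n R) : A.map (RingHom.id R) = A := rfl

theorem map_d (f : R →+* S) (A : BasedAlg n R) (i : Fin n) : (A.map f).d i = f (A.d i) := rfl

theorem map_c (f : R →+* S) (A : BasedAlg n R) (i j l : Fin n) :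
    (A.map f).c i j l = f (A.c i j l) := rfl

/-- The based algebra obtained from `A` by the linear change of coordinates `G`. -/
def conj (G : (Matrix (Fin n) (Fin n) R)ˣ) (A : BasedAlg n R) : BasedAlg n R :=
  ofMul ((A.mul.compl₁₂ (G⁻¹).1.mulVecLin (G⁻¹).1.mulVecLin).compr₂ G.1.mulVecLin) (G.1 *ᵥ A.d)
    (fun x y => by simp [A.mul_comm (_ *ᵥ x)])
    (fun x y z => by simp [A.mul_assoc, -Matrix.coe_units_inv])
    (fun x => by simp [A.d_mul, -Matrix.coe_units_inv])

theorem mul_conj (G : (Matrix (Fin n) (Fin n) R)ˣ) (A : BasedAlg n R) (x y : Fin n → R) :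
    (A.conj G).mul x y = G.1 *ᵥ A.mul ((G⁻¹).1 *ᵥ x) ((G⁻¹).1 *ᵥ y) := by
  simp only [conj, mul_ofMul]; rfl

@[simp]
theorem conj_d (G : (Matrix (Fin n) (Fin n) R)ˣ) (A : BasedAlg n R) :
    (A.conj G).d = G.1 *ᵥ A.d := rfl

theorem conj_conj_inv (G : (Matrix (Fin n) (Fin n) R)ˣ) (A : BasedAlg n R) :
    (A.conj G⁻¹).conj G = A := by
  refine ext_mul (LinearMap.ext fun x => LinearMap.ext fun y => ?_) ?_
  · simp [mul_conj, -Matrix.coe_units_inv]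
  · simp [-Matrix.coe_units_inv]

theorem map_conj (f : R →+* S) (G : (Matrix (Fin n) (Fin n) R)ˣ) (A : BasedAlg n R) :
    (A.conj G).map f = (A.map f).conj (Units.map f.mapMatrix.toMonoidHom G) := by
  have hf (M : Matrix (Fin n) (Fin n) R) (v : Fin n → R) :
      f ∘ (M *ᵥ v) = f.mapMatrix M *ᵥ (f ∘ v) := by
    ext i; simp [RingHom.map_mulVec]
  have hs (i : Fin n) : (Pi.single i 1 : Fin n → S) = f ∘ (Pi.single i 1 : Fin n → R) := by
    ext j; simp [Pi.single_apply, apply_ite f]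
  -- Vectors over `S` need not come from `R`, but the standard basis vectors do, and they suffice.
  refine ext_mul ((Pi.basisFun S (Fin n)).ext fun i => (Pi.basisFun S (Fin n)).ext fun j => ?_) ?_
  · rw [Pi.basisFun_apply, Pi.basisFun_apply, hs, hs, map_mul, mul_conj, hf, ← map_mul, hf, hf,
      mul_conj]
    rfl
  · exact hf G.1 A.d

end BasedAlg

end ModuliAlg

/-! ### Unital algebras, deformations of the square-zero algebra, and split algebras -/

namespace ModuliAlg

open Matrix

namespace BasedAlg

variable {n : ℕ} {R S T : Type*} [CommRing R] [CommRing S] [CommRing T]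

/-- The first basis vector is the multiplicative identity. -/
abbrev IsUnital (A : BasedAlg n R) : Prop := ∀ i : Fin n, A.d i = if i.val = 0 then 1 else 0

theorem IsUnital.map {A : BasedAlg n R} (h : A.IsUnital) (f : R →+* S) : (A.map f).IsUnital :=
  fun i => by rw [map_d, h i]; split_ifs <;> simp

theorem IsUnital.c_zero {A : BasedAlg n R} (h : A.IsUnital) {i : Fin n} (hi : i.val = 0)
    (j l : Fin n) : A.c i j l = if j = l then 1 else 0 := by
  rw [← A.one_mul j l, Finset.sum_eq_single i]
  · rw [h i, if_pos hi, _root_.one_mul]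
  · intro b _ hb
    rw [h b, if_neg fun h0 => hb (Fin.ext (h0.trans hi.symm)), zero_mul]
  · simp

theorem IsUnital.c_zero_right {A : BasedAlg n R} (h : A.IsUnital) {j : Fin n} (hj : j.val = 0)
    (i l : Fin n) : A.c i j l = if i = l then 1 else 0 := by
  rw [A.comm, h.c_zero hj]

/-- The deformation `x i * x j = e • ∑ l, γ i j l • x l` of the square-zero algebra, where `e` has
square zero and `γ` is only used for nonzero indices. -/
def deform (n : ℕ) (e : R) (he : e * e = 0) (γ : Fin n → Fin n → Fin n → R)
    (hγ : ∀ i j l, γ i j l = γ j i l) (hγ0 : ∀ i j l, l.val = 0 → γ i j l = 0) : BasedAlg n R where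
  c i j l := if i.val = 0 then (if j = l then 1 else 0)
    else if j.val = 0 then (if i = l then 1 else 0) else e * γ i j l
  d i := if i.val = 0 then 1 else 0
  comm i j l := by
    by_cases hi : i.val = 0 <;> by_cases hj : j.val = 0 <;> simp [hi, hj]
    · simp [show i = j from Fin.ext (hi.trans hj.symm)]
    · rw [hγ]
  assoc i j l p := by
    by_cases hi : i.val = 0
    · simp only [hi, if_true]
      rw [Finset.sum_eq_single j, Finset.sum_eq_single p] <;> simp +contextual [eq_comm]
    · by_cases hj : j.val = 0
      · simp only [hi, hj, if_true, if_false, ite_mul, _root_.one_mul, zero_mul,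
          Finset.sum_ite_eq, Finset.mem_univ]
      · by_cases hl : l.val = 0
        · rw [Finset.sum_eq_single p, Finset.sum_eq_single j]
          · by_cases hp : p.val = 0
            · simp [hi, hj, hl, hp, hγ0 _ _ _ hp]
            · simp [hi, hj, hl, hp]
          · intro b _ hb
            simp [hj, hl, hb.symm]
          · simp
          · intro b _ hb
            by_cases hb0 : b.val = 0
            · simp [hi, hj, hb0, hγ0 _ _ _ hb0]
            · simp [hl, hb0, hb]
          · simp
        · simp only [hi, hj, hl, if_false]
          -- For three nonidentity basis vectors every term of either bracketing carries the factor
          -- `e * e = 0`, or a coefficient of the identity, which is zero.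
          rw [Finset.sum_eq_zero, Finset.sum_eq_zero]
          · intro m _
            split_ifs with hm hip
            · simp [hγ0 _ _ _ hm]
            · simp
            · linear_combination γ j l m * γ i m p * he
          · intro m _
            split_ifs with hm hip
            · simp [hγ0 _ _ _ hm]
            · simp
            · linear_combination γ i j m * γ m l p * he
  one_mul j l := by
    have h0 : 0 < n := j.pos
    rw [Finset.sum_eq_single (⟨0, h0⟩ : Fin n)]
    · simp
    · intro b _ hb
      have : b.val ≠ 0 := fun h => hb (Fin.ext h)
      simp [this]
    · simp

theorem squareZero_isUnital : (squareZero n R).IsUnital := fun _ => rfl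

/-- The product algebra `Rⁿ` with its standard basis. -/
def prod (n : ℕ) (R : Type*) [CommRing R] : BasedAlg n R :=
  ofMul (LinearMap.mul R (Fin n → R)) 1 (fun x y => by simp [_root_.mul_comm])
    (fun x y z => by simp [_root_.mul_assoc]) (fun x => by simp)

/-- The product algebra with the basis given by the columns of an invertible matrix. -/
def ofMatrix (M : (Matrix (Fin n) (Fin n) R)ˣ) : BasedAlg n R := (prod n R).conj M⁻¹

theorem mul_ofMatrix (M : (Matrix (Fin n) (Fin n) R)ˣ) (x y : Fin n → R) :
    (ofMatrix M).mul x y = (M⁻¹).1 *ᵥ ((M.1 *ᵥ x) * (M.1 *ᵥ y)) := by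
  rw [ofMatrix, mul_conj, inv_inv, prod, mul_ofMul, LinearMap.mul_apply']

theorem ofMatrix_d (M : (Matrix (Fin n) (Fin n) R)ˣ) : (ofMatrix M).d = (M⁻¹).1 *ᵥ 1 := rfl

theorem ofMatrix_c (M : (Matrix (Fin n) (Fin n) R)ˣ) (i j l : Fin n) :
    (ofMatrix M).c i j l = ∑ s, (M⁻¹).1 l s * (M.1 s i * M.1 s j) := by
  rw [← mul_single, mul_ofMatrix]
  simp [Matrix.mulVec, dotProduct, -Matrix.coe_units_inv]

theorem map_ofMatrix (f : R →+* S) (M : (Matrix (Fin n) (Fin n) R)ˣ) :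
    (ofMatrix M).map f = ofMatrix (Units.map f.mapMatrix.toMonoidHom M) := by
  ext i j l
  · rw [map_c, ofMatrix_c, ofMatrix_c, ← map_inv]
    simp [-Matrix.coe_units_inv]
  · rw [map_d, ofMatrix_d, ofMatrix_d, ← map_inv]
    simp [-Matrix.coe_units_inv, mulVec, dotProduct]

/-- The first column of `M` is the first basis vector as an element of `Rⁿ`, so it must be the
identity `1` of `Rⁿ`. -/
theorem ofMatrix_isUnital (M : (Matrix (Fin n) (Fin n) R)ˣ)
    (h : ∀ i j : Fin n, j.val = 0 → M.1 i j = 1) : (ofMatrix M).IsUnital := by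
  intro i
  have h0 : M.1 *ᵥ (Pi.single ⟨0, i.pos⟩ 1) = 1 := by
    ext j; simp [h j ⟨0, i.pos⟩ rfl]
  rw [ofMatrix_d, ← h0, mulVec_mulVec, Units.inv_mul, one_mulVec, Pi.single_apply]
  simp [Fin.ext_iff]

/-- The trace form of `Rⁿ` is the standard dot product, so its Gram matrix in the basis of columns
of `M` is `Mᵀ * M`. -/
theorem disc_ofMatrix (M : (Matrix (Fin n) (Fin n) R)ˣ) : (ofMatrix M).disc = M.1.det ^ 2 := by
  have h (l : Fin n) : ∑ m, (ofMatrix M).c l m m = ∑ s, M.1 s l := by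
    simp only [ofMatrix_c]
    rw [Finset.sum_comm]
    refine Finset.sum_congr rfl fun s _ => ?_
    have := congrFun (congrFun M.mul_inv s) s
    rw [Matrix.mul_apply, one_apply_eq] at this
    calc ∑ m, (M⁻¹).1 m s * (M.1 s l * M.1 s m) = M.1 s l * ∑ m, M.1 s m * (M⁻¹).1 m s := by
          rw [Finset.mul_sum]
          exact Finset.sum_congr rfl fun m _ => by ring
      _ = M.1 s l := by rw [this, mul_one]
  have : (of fun i j => ∑ l, (ofMatrix M).c i j l * ∑ m, (ofMatrix M).c l m m) = M.1ᵀ * M.1 := by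
    ext i j
    simp only [of_apply, h, Matrix.mul_apply, transpose_apply]
    have hv := congrArg (fun v => ∑ s, (M.1 *ᵥ v) s) (mul_ofMatrix M (Pi.single i 1) (Pi.single j 1))
    simp only [mul_single, mulVec_mulVec, Units.mul_inv, one_mulVec] at hv
    simp only [mulVec_single_one, Pi.mul_apply, col_apply] at hv
    rw [← hv]
    simp only [mulVec, dotProduct, Finset.mul_sum]
    rw [Finset.sum_comm]
    exact Finset.sum_congr rfl fun s _ => Finset.sum_congr rfl fun l _ => _root_.mul_comm _ _
  rw [disc, this, det_mul, det_transpose, sq]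

theorem map_disc (f : R →+* S) (A : BasedAlg n R) : (A.map f).disc = f A.disc := by
  rw [disc, disc, RingHom.map_det]
  congr 1
  ext i j
  simp [map_c]

end BasedAlg

end ModuliAlg

/-! ### Universal properties of the coordinate rings -/

namespace ModuliAlg

open Matrix

open BasedAlg

/-- The universal based algebra whose first basis vector is the identity. -/
noncomputable def univ1 (n : ℕ) : BasedAlg n (CoordRing1 n) := (univ n).map (restrict1 n)

theorem univ1_c (n : ℕ) (i j l : Fin n) :
    (univ1 n).c i j l = Ideal.Quotient.mk (Ideal.span (relations1 n)) (varC i j l) := rfl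

theorem univ1_d (n : ℕ) (i : Fin n) :
    (univ1 n).d i = Ideal.Quotient.mk (Ideal.span (relations1 n)) (varD i) := rfl

theorem univ1_isUnital (n : ℕ) : (univ1 n).IsUnital := by
  intro i
  have h : Ideal.Quotient.mk (Ideal.span (relations1 n)) (varD i - if i.val = 0 then 1 else 0) = 0 :=
    Ideal.Quotient.eq_zero_iff_mem.2 (Ideal.subset_span (Or.inr ⟨i, rfl⟩))
  rw [map_sub, sub_eq_zero] at h
  rw [univ1_d, h]
  split_ifs <;> simp

section Points

variable {n : ℕ} {R : Type*} [CommRing R]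

theorem classify1_mk (A : BasedAlg n R) (h : A.IsUnital) (x : MvPolynomial (Var n) ℤ) :
    A.classify1 h (Ideal.Quotient.mk (Ideal.span (relations1 n)) x) = A.evalHom x := rfl

theorem univ1_map_classify1 (A : BasedAlg n R) (h : A.IsUnital) :
    (univ1 n).map (A.classify1 h) = A := by
  ext
  · rw [map_c, univ1_c, classify1_mk]
    simp [evalHom, varC]
  · rw [map_d, univ1_d, classify1_mk]
    simp [evalHom, varD]

/-- The coordinate ring is generated by the constants of its universal algebra. -/
theorem ringHom_ext1 {f g : CoordRing1 n →+* R} (h : (univ1 n).map f = (univ1 n).map g) :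
    f = g := by
  refine Ideal.Quotient.ringHom_ext (MvPolynomial.ringHom_ext (by simp) ?_)
  rintro (⟨i, j, l⟩ | i)
  · have := congrFun (congrFun (congrFun (congrArg BasedAlg.c h) i) j) l
    rwa [map_c, map_c, univ1_c] at this
  · have := congrFun (congrArg BasedAlg.d h) i
    rwa [map_d, map_d, univ1_d] at this

end Points

section Field

variable (n : ℕ) (k : Type u) [CommRing k]

/-- The universal based algebra over the base change to `k`. -/
noncomputable def univk : BasedAlg n (k ⊗[ℤ] CoordRing n) :=
  (univ n).map Algebra.TensorProduct.includeRight.toRingHom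

/-- The universal based algebra over the base change to `k` whose first basis vector is `1`. -/
noncomputable def univ1k : BasedAlg n (k ⊗[ℤ] CoordRing1 n) :=
  (univ1 n).map Algebra.TensorProduct.includeRight.toRingHom

theorem univ1k_isUnital : (univ1k n k).IsUnital := (univ1_isUnital n).map _

variable {n k} {R : Type*} [CommRing R] [Algebra k R]

/-- The homomorphism of `k`-algebras classifying a based algebra. -/
noncomputable def classifyk (k : Type u) [CommRing k] [Algebra k R] (A : BasedAlg n R) :
    k ⊗[ℤ] CoordRing n →ₐ[k] R :=
  Algebra.TensorProduct.lift (Algebra.ofId k R) A.classify.toIntAlgHom fun _ _ => Commute.all _ _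

/-- The homomorphism of `k`-algebras classifying a based algebra whose first basis vector is `1`. -/
noncomputable def classify1k (k : Type u) [CommRing k] [Algebra k R] (A : BasedAlg n R)
    (h : A.IsUnital) : k ⊗[ℤ] CoordRing1 n →ₐ[k] R :=
  Algebra.TensorProduct.lift (Algebra.ofId k R) (A.classify1 h).toIntAlgHom
    fun _ _ => Commute.all _ _

theorem univk_map_classifyk (A : BasedAlg n R) :
    (univk n k).map (classifyk k A).toRingHom = A := by
  have : (classifyk k A).toRingHom.comp Algebra.TensorProduct.includeRight.toRingHom =
      A.classify := by
    refine RingHom.ext fun x => ?_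
    refine (Algebra.TensorProduct.lift_tmul _ _ (fun _ _ => Commute.all _ _) _ _).trans ?_
    rw [map_one, _root_.one_mul]
    rfl
  rw [univk, BasedAlg.map_map, this]
  exact (pointsEquiv n R).left_inv A

theorem univ1k_map_classify1k (A : BasedAlg n R) (h : A.IsUnital) :
    (univ1k n k).map (classify1k k A h).toRingHom = A := by
  have : (classify1k k A h).toRingHom.comp Algebra.TensorProduct.includeRight.toRingHom =
      A.classify1 h := by
    refine RingHom.ext fun x => ?_
    refine (Algebra.TensorProduct.lift_tmul _ _ (fun _ _ => Commute.all _ _) _ _).trans ?_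
    rw [map_one, _root_.one_mul]
    rfl
  rw [univ1k, BasedAlg.map_map, this, univ1_map_classify1]

theorem algHom_ext1k {f g : k ⊗[ℤ] CoordRing1 n →ₐ[k] R}
    (h : (univ1k n k).map f.toRingHom = (univ1k n k).map g.toRingHom) : f = g := by
  have := ringHom_ext1 (f := f.toRingHom.comp Algebra.TensorProduct.includeRight.toRingHom)
    (g := g.toRingHom.comp Algebra.TensorProduct.includeRight.toRingHom) h
  refine Algebra.TensorProduct.ext (Algebra.ext_id _ _ _) (AlgHom.ext fun x => ?_)
  exact RingHom.congr_fun this x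

end Field

end ModuliAlg

/-! ### Ranks at most three: affine spaces -/

namespace ModuliAlg

open BasedAlg

/-- If unital based algebras of rank `n` are functorially and uniquely determined by arbitrary
values of a set of structure constants, then their coordinate ring is a polynomial ring. -/
noncomputable def coordRing1Equiv {n : ℕ} {σ : Type} (idx : σ → Fin n × Fin n × Fin n)
    (mk : ∀ (R : Type) [CommRing R], (σ → R) → BasedAlg n R)
    (mk_isUnital : ∀ (R : Type) [CommRing R] (v : σ → R), (mk R v).IsUnital)
    (map_mk : ∀ (R S : Type) [CommRing R] [CommRing S] (f : R →+* S) (v : σ → R),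
      (mk R v).map f = mk S (f ∘ v))
    (mk_c : ∀ (R : Type) [CommRing R] (v : σ → R) (s : σ),
      (mk R v).c (idx s).1 (idx s).2.1 (idx s).2.2 = v s)
    (mk_eq : ∀ (R : Type) [CommRing R] (A : BasedAlg n R), A.IsUnital →
      mk R (fun s => A.c (idx s).1 (idx s).2.1 (idx s).2.2) = A) :
    CoordRing1 n ≃+* MvPolynomial σ ℤ :=
  RingEquiv.ofRingHom ((mk _ MvPolynomial.X).classify1 (mk_isUnital _ _))
    (MvPolynomial.eval₂Hom (Int.castRingHom _)
      fun s => (univ1 n).c (idx s).1 (idx s).2.1 (idx s).2.2)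
    (by
      refine MvPolynomial.ringHom_ext (by simp) fun s => ?_
      simp only [RingHom.comp_apply, MvPolynomial.coe_eval₂Hom, MvPolynomial.eval₂_X,
        RingHom.id_apply]
      rw [← map_c, univ1_map_classify1, mk_c])
    (by
      refine ringHom_ext1 ?_
      rw [← BasedAlg.map_map, univ1_map_classify1, map_mk, BasedAlg.map_id]
      conv_rhs => rw [← mk_eq _ (univ1 n) (univ1_isUnital n)]
      congr 1
      ext s
      simp)

theorem BasedAlg.ext_zero {R : Type*} [CommRing R] (A B : BasedAlg 0 R) : A = B := by
  ext i
  · exact i.elim0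
  · exact i.elim0

/-- The coordinate ring in rank 0 is the integers. -/
noncomputable def coordRing1Zero : CoordRing1 0 ≃+* MvPolynomial (Fin 0) ℤ :=
  coordRing1Equiv (fun s => s.elim0) (fun R _ _ => squareZero 0 R) (fun _ _ _ i => i.elim0)
    (fun _ _ _ _ _ _ => ext_zero _ _) (fun _ _ _ s => s.elim0) fun _ _ _ _ => ext_zero _ _

theorem BasedAlg.IsUnital.ext_one {R : Type*} [CommRing R] {A B : BasedAlg 1 R}
    (hA : A.IsUnital) (hB : B.IsUnital) : A = B := by
  ext i j l
  · rw [hA.c_zero (by omega), hB.c_zero (by omega)]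
  · rw [hA, hB]

/-- The coordinate ring in rank 1 is the integers. -/
noncomputable def coordRing1One : CoordRing1 1 ≃+* MvPolynomial (Fin 0) ℤ :=
  coordRing1Equiv (fun s => s.elim0) (fun R _ _ => squareZero 1 R) (fun _ _ _ _ => rfl)
    (fun _ _ _ _ f _ => (squareZero_isUnital.map f).ext_one squareZero_isUnital)
    (fun _ _ _ s => s.elim0) fun _ _ _ h => squareZero_isUnital.ext_one h

/-- The quadratic algebra with `x * x = v 0 + v 1 * x`. -/
def BasedAlg.quadratic {R : Type*} [CommRing R] (v : Fin 2 → R) : BasedAlg 2 R where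
  c := ![![![1, 0], ![0, 1]], ![![0, 1], ![v 0, v 1]]]
  d := ![1, 0]
  comm i j l := by fin_cases i <;> fin_cases j <;> rfl
  assoc i j l p := by
    fin_cases i <;> fin_cases j <;> fin_cases l <;> fin_cases p <;> simp
  one_mul j l := by fin_cases j <;> fin_cases l <;> simp

theorem BasedAlg.quadratic_isUnital {R : Type*} [CommRing R] (v : Fin 2 → R) :
    (quadratic v).IsUnital := by
  intro i; fin_cases i <;> rfl

/-- The coordinate ring in rank 2 is a polynomial ring in two variables. -/
noncomputable def coordRing1Two : CoordRing1 2 ≃+* MvPolynomial (Fin 2) ℤ :=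
  coordRing1Equiv (fun s => (1, 1, s)) (fun _ _ v => quadratic v)
    (fun _ _ => quadratic_isUnital)
    (fun _ _ _ _ f v => by
      ext i j l
      · fin_cases i <;> fin_cases j <;> fin_cases l <;> simp [BasedAlg.map, quadratic]
      · fin_cases i <;> simp [BasedAlg.map, quadratic])
    (fun _ _ v s => by fin_cases s <;> rfl)
    (fun _ _ A h => by
      ext i j l
      · rcases Fin.exists_fin_two.1 ⟨i, rfl⟩ with rfl | rfl
        · rw [h.c_zero rfl, (quadratic_isUnital _).c_zero rfl]
        · rcases Fin.exists_fin_two.1 ⟨j, rfl⟩ with rfl | rfl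
          · rw [h.c_zero_right rfl, (quadratic_isUnital _).c_zero_right rfl]
          · fin_cases l <;> rfl
      · rw [h, quadratic_isUnital])

/-- The cubic algebra with `x * x = p₀ + v 0 * x + v 1 * y`, `x * y = q₀ + v 2 * x + v 3 * y` and
`y * y = r₀ + v 4 * x + v 5 * y`, where `p₀`, `q₀`, `r₀` are determined by associativity. -/
def BasedAlg.cubic {R : Type*} [CommRing R] (v : Fin 6 → R) : BasedAlg 3 R where
  c := ![![![1, 0, 0], ![0, 1, 0], ![0, 0, 1]],
    ![![0, 1, 0], ![v 2 * v 1 + v 3 * v 3 - v 0 * v 3 - v 1 * v 5, v 0, v 1],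
      ![v 1 * v 4 - v 2 * v 3, v 2, v 3]],
    ![![0, 0, 1], ![v 1 * v 4 - v 2 * v 3, v 2, v 3],
      ![v 3 * v 4 + v 2 * v 2 - v 5 * v 2 - v 4 * v 0, v 4, v 5]]]
  d := ![1, 0, 0]
  comm i j l := by fin_cases i <;> fin_cases j <;> rfl
  assoc i j l p := by
    fin_cases i <;> fin_cases j <;> fin_cases l <;> fin_cases p <;>
      simp [Fin.sum_univ_three] <;> ring
  one_mul j l := by fin_cases j <;> fin_cases l <;> simp [Fin.sum_univ_three]

theorem BasedAlg.cubic_isUnital {R : Type*} [CommRing R] (v : Fin 6 → R) :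
    (cubic v).IsUnital := by
  intro i; fin_cases i <;> rfl

/-- With basis `1, x, y`, the coefficients of `y` and `x` in `(xx)y = x(xy)` determine the constant
terms of `xx` and `xy`, and the coefficient of `x` in `(xy)y = x(yy)` determines that of `yy`. -/
theorem BasedAlg.IsUnital.eq_cubic {R : Type*} [CommRing R] {A : BasedAlg 3 R} (h : A.IsUnital) :
    A = cubic ![A.c 1 1 1, A.c 1 1 2, A.c 1 2 1, A.c 1 2 2, A.c 2 2 1, A.c 2 2 2] := by
  have h0 := fun j l => h.c_zero (i := 0) rfl j l
  have h0' := fun j l => h.c_zero_right (j := 0) rfl j l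
  have h21 := A.comm 2 1
  have e1 := A.assoc 1 1 2 1
  have e2 := A.assoc 1 1 2 2
  have e3 := A.assoc 1 2 2 1
  simp only [Fin.sum_univ_three, h0, h0'] at e1 e2 e3
  simp at e1 e2 e3
  ext i j l
  · fin_cases i <;> fin_cases j <;> fin_cases l <;> simp [cubic, h0, h0', h21]
    · linear_combination e2
    · linear_combination -e1
    · linear_combination -e1
    · linear_combination -e3
  · fin_cases i <;> simp [h _, cubic]

/-- The coordinate ring in rank 3 is a polynomial ring in six variables. -/
noncomputable def coordRing1Three : CoordRing1 3 ≃+* MvPolynomial (Fin 6) ℤ :=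
  coordRing1Equiv ![(1, 1, 1), (1, 1, 2), (1, 2, 1), (1, 2, 2), (2, 2, 1), (2, 2, 2)]
    (fun _ _ v => cubic v) (fun _ _ => cubic_isUnital)
    (fun _ _ _ _ f v => by
      ext i j l
      · fin_cases i <;> fin_cases j <;> fin_cases l <;> simp [BasedAlg.map, cubic]
      · fin_cases i <;> simp [BasedAlg.map, cubic])
    (fun _ _ v s => by fin_cases s <;> rfl)
    (fun _ _ A h => by
      conv_rhs => rw [h.eq_cubic]
      congr 1
      ext s
      fin_cases s <;> rfl)

/-- An isomorphism of the coordinate ring with a polynomial ring gives an isomorphism of `B1 n`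
with an affine space. -/
noncomputable def B1IsoAffineSpace {n : ℕ} {σ : Type} (e : CoordRing1 n ≃+* MvPolynomial σ ℤ) :
    B1 n ≅ AffineSpace σ (Spec (.of ℤ)) :=
  Scheme.Spec.mapIso e.toCommRingCatIso.symm.op ≪≫ (AffineSpace.SpecIso σ (.of ℤ)).symm

theorem smooth_coordRing1 {n : ℕ} (hn : n ≤ 3) : Algebra.Smooth ℤ (CoordRing1 n) := by
  have h {σ : Type} [Finite σ] (e : CoordRing1 n ≃+* MvPolynomial σ ℤ) :
      Algebra.Smooth ℤ (CoordRing1 n) :=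
    have : Algebra.Smooth ℤ (MvPolynomial σ ℤ) := ⟨inferInstance, inferInstance⟩
    Algebra.Smooth.of_equiv (AlgEquiv.ofRingEquiv (f := e.symm) fun r => by simp)
  interval_cases n
  exacts [h coordRing1Zero, h coordRing1One, h coordRing1Two, h coordRing1Three]

end ModuliAlg

/-! ### From unital algebras to all based algebras: smoothness in rank at most three -/

namespace ModuliAlg

open BasedAlg Matrix

section UnitVector

variable {n : ℕ} {R S : Type*} [CommRing R] [CommRing S]

/-- A vector with a unit coordinate is the first column of an invertible matrix. -/
theorem exists_units_mulVec_single {d : Fin n → R} {i : Fin n} (hi : IsUnit (d i)) :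
    ∃ G : (Matrix (Fin n) (Fin n) R)ˣ, G.1 *ᵥ (Pi.single ⟨0, i.pos⟩ 1) = d := by
  set z : Fin n := ⟨0, i.pos⟩
  let P : Matrix (Fin n) (Fin n) R := updateCol 1 z (d ∘ Equiv.swap z i)
  have hP : IsUnit P := by
    rw [Matrix.isUnit_iff_isUnit_det, ← Matrix.cramer_apply, Matrix.cramer_one]
    simpa using hi
  have hσ : IsUnit ((Equiv.swap z i).permMatrix R) := by
    rw [Matrix.isUnit_iff_isUnit_det, Matrix.det_permutation]
    exact (Units.isUnit _).map (Int.castRingHom R)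
  refine ⟨hσ.unit * hP.unit, ?_⟩
  have hPz : P *ᵥ (Pi.single z 1) = d ∘ Equiv.swap z i := by
    ext j; simp [P]
  rw [Units.val_mul, IsUnit.unit_spec, IsUnit.unit_spec, ← mulVec_mulVec, hPz, permMatrix_mulVec]
  ext j
  simp

/-- One Newton step turns an approximate inverse `y` into the inverse `y * (2 - x * y)`, since the
error `x * y - 1` squares to zero. -/
theorem isUnit_of_isUnit_mk {I : Ideal R} (hI : I ^ 2 = ⊥) {x : R}
    (hx : IsUnit (Ideal.Quotient.mk I x)) : IsUnit x := by
  obtain ⟨y, hy⟩ := hx.exists_right_inv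
  obtain ⟨y, rfl⟩ := Ideal.Quotient.mk_surjective y
  rw [← _root_.map_mul, ← map_one (Ideal.Quotient.mk I), Ideal.Quotient.eq] at hy
  have h0 : (x * y - 1) * (x * y - 1) = 0 := by
    have := Ideal.mul_mem_mul hy hy
    rwa [← sq, hI, Ideal.mem_bot] at this
  exact IsUnit.of_mul_eq_one (y * (2 - x * y)) (by linear_combination -h0)

/-- Based algebras with a unit coordinate in their identity lift along square-zero extensions if
unital ones do. -/
theorem BasedAlg.exists_lift (I : Ideal R) (hI : I ^ 2 = ⊥)
    (H : ∀ A : BasedAlg n (R ⧸ I), A.IsUnital →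
      ∃ B : BasedAlg n R, B.map (Ideal.Quotient.mk I) = A)
    (A : BasedAlg n (R ⧸ I)) {i : Fin n} (hi : IsUnit (A.d i)) :
    ∃ B : BasedAlg n R, B.map (Ideal.Quotient.mk I) = A := by
  choose d hd using fun j => Ideal.Quotient.mk_surjective (I := I) (A.d j)
  have hdi : IsUnit (d i) := by
    refine isUnit_of_isUnit_mk hI ?_
    rwa [hd]
  obtain ⟨G, hG⟩ := exists_units_mulVec_single hdi
  -- The change of basis is chosen over `R`, so its reduction makes `A` unital and, once that unital
  -- algebra is lifted, `G` itself undoes the change.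
  set G' := Units.map (Ideal.Quotient.mk I).mapMatrix.toMonoidHom G with hG'
  have hG'1 : G'.1 *ᵥ (Pi.single ⟨0, i.pos⟩ 1) = A.d := by
    ext j
    have := congrArg (fun v => Ideal.Quotient.mk I (v j)) hG
    simp only [hd] at this
    rw [← this]
    simp [G']
  obtain ⟨B, hB⟩ := H (A.conj G'⁻¹) fun j => by
    rw [conj_d, ← hG'1, mulVec_mulVec, Units.inv_mul, one_mulVec, Pi.single_apply]
    simp [Fin.ext_iff]
  exact ⟨B.conj G, by rw [map_conj, hB, ← hG', conj_conj_inv]⟩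

end UnitVector

theorem pointsEquiv_symm_apply {n : ℕ} {R : Type*} [CommRing R] (f : CoordRing n →+* R) :
    (pointsEquiv n R).symm f = (univ n).map f := rfl

theorem univ_map_classify {n : ℕ} {R : Type*} [CommRing R] (A : BasedAlg n R) :
    (univ n).map A.classify = A := (pointsEquiv n R).left_inv A

/-- A single coefficient of `1 * e₀ = e₀` exhibits `1` as a combination of the `d i`. Hence the loci
where some `d i` is invertible cover the scheme. -/
theorem BasedAlg.span_d {n : ℕ} {R : Type*} [CommRing R] (A : BasedAlg n R) (hn : n ≠ 0) :
    Ideal.span (Set.range A.d) = ⊤ := by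
  rw [Ideal.eq_top_iff_one]
  have h := A.one_mul ⟨0, by omega⟩ ⟨0, by omega⟩
  rw [if_pos rfl] at h
  rw [← h]
  exact Ideal.sum_mem _ fun i _ => Ideal.mul_mem_right _ _ (Ideal.subset_span ⟨i, rfl⟩)

theorem finitePresentation_coordRing (n : ℕ) : Algebra.FinitePresentation ℤ (CoordRing n) :=
  Algebra.FinitePresentation.quotient (IsNoetherian.noetherian _)

/-- A point of this localization is a based algebra with `d i` invertible. Such algebras lift, and
`d i` stays a unit in the lift, so the lifted classifying map factors through the localization
again. -/
theorem formallySmooth_away {n : ℕ} (h : Algebra.FormallySmooth ℤ (CoordRing1 n)) (i : Fin n) :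
    Algebra.FormallySmooth ℤ (Localization.Away ((univ n).d i)) := by
  refine Algebra.FormallySmooth.of_comp_surjective fun B _ _ I hI f => ?_
  let a := algebraMap (CoordRing n) (Localization.Away ((univ n).d i))
  let A : BasedAlg n (B ⧸ I) := (univ n).map (f.toRingHom.comp a)
  have hA : IsUnit (A.d i) :=
    (IsLocalization.Away.algebraMap_isUnit (S := Localization.Away ((univ n).d i))
      ((univ n).d i)).map f.toRingHom
  obtain ⟨C, hC⟩ := BasedAlg.exists_lift I hI (fun A hA => by
    let φ : CoordRing1 n →ₐ[ℤ] B ⧸ I := ⟨A.classify1 hA, fun r => by simp⟩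
    obtain ⟨g, hg⟩ := Algebra.FormallySmooth.comp_surjective ℤ (CoordRing1 n) I hI φ
    refine ⟨(univ1 n).map g.toRingHom, ?_⟩
    rw [BasedAlg.map_map]
    conv_rhs => rw [← univ1_map_classify1 A hA]
    congr 1
    exact RingHom.ext fun x => DFunLike.congr_fun hg x) A hA
  have hCf : (Ideal.Quotient.mk I).comp C.classify = f.toRingHom.comp a :=
    (pointsEquiv n _).symm.injective (by
      rw [pointsEquiv_symm_apply, pointsEquiv_symm_apply, ← BasedAlg.map_map, univ_map_classify, hC])
  have hu : IsUnit (C.classify ((univ n).d i)) := by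
    refine isUnit_of_isUnit_mk hI ?_
    rw [← RingHom.comp_apply, hCf]
    exact hA
  let g : Localization.Away ((univ n).d i) →ₐ[ℤ] B :=
    ⟨IsLocalization.Away.lift ((univ n).d i) hu, fun r => by simp⟩
  refine ⟨g, AlgHom.coe_ringHom_injective ?_⟩
  refine IsLocalization.ringHom_ext (Submonoid.powers ((univ n).d i)) ?_
  refine Eq.trans ?_ hCf
  refine RingHom.ext fun x => congrArg (Ideal.Quotient.mk I) ?_
  exact IsLocalization.Away.lift_eq ((univ n).d i) hu x

theorem smooth_coordRing {n : ℕ} (hn : n ≤ 3) : Algebra.Smooth ℤ (CoordRing n) := by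
  -- In rank zero there are no `d i` to cover with; the coordinate ring is `ℤ` itself.
  rcases eq_or_ne n 0 with rfl | hn0
  · have h : Function.Injective (algebraMap ℤ (CoordRing 0)) := by
      refine Function.LeftInverse.injective (g := (squareZero 0 ℤ).classify) fun x => by simp
    have h' : Function.Surjective (algebraMap ℤ (CoordRing 0)) := by
      have : (algebraMap ℤ (CoordRing 0)).comp (squareZero 0 ℤ).classify = RingHom.id _ :=
        (pointsEquiv 0 _).symm.injective (ext_zero _ _)
      exact fun x => ⟨_, RingHom.congr_fun this x⟩
    exact (RingHom.smooth_algebraMap ..).1 (RingHom.Smooth.of_bijective ⟨h, h'⟩)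
  · rw [← RingHom.smooth_algebraMap]
    refine RingHom.Smooth.ofLocalizationSpanTarget _ _ ((univ n).span_d hn0) ?_
    rintro ⟨_, i, rfl⟩
    have := (smooth_coordRing1 hn).formallySmooth
    have := formallySmooth_away this i
    have := finitePresentation_coordRing n
    have : Algebra.FinitePresentation (CoordRing n) (Localization.Away ((univ n).d i)) :=
      IsLocalization.Away.finitePresentation ((univ n).d i)
    have : Algebra.FinitePresentation ℤ (Localization.Away ((univ n).d i)) :=
      Algebra.FinitePresentation.trans ℤ (CoordRing n) _
    rw [← IsScalarTower.algebraMap_eq]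
    rw [RingHom.smooth_algebraMap]
    exact ⟨inferInstance, inferInstance⟩

end ModuliAlg

/-! ### Rank at least four: an obstructed deformation -/

namespace ModuliAlg

open BasedAlg Polynomial

section Obstruction

variable {n : ℕ} {R : Type*} [CommRing R]

/-- The structure constants of a first order deformation with `x₁² = x₂` and `x₂² = x₃`. -/
def obstructed (n : ℕ) (R : Type*) [CommRing R] (i j l : Fin n) : R :=
  if i.val = 1 ∧ j.val = 1 ∧ l.val = 2 ∨ i.val = 2 ∧ j.val = 2 ∧ l.val = 3 then 1 else 0

theorem obstructed_comm (i j l : Fin n) : obstructed n R i j l = obstructed n R j i l := by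
  simp only [obstructed]
  congr 1
  grind

theorem obstructed_zero (i j l : Fin n) (hl : l.val = 0) : obstructed n R i j l = 0 :=
  if_neg (by omega)

/-- In a lift `A`, compare the coefficients of `e₃` in `(e₁e₁)e₂` and `e₁(e₁e₂)`. On the left `e₁e₁
≈ x e₂` and `e₂e₂ ≈ x e₃` contribute `x ^ 2`; all other terms have a factor divisible by `x ^ 2` and
one divisible by `x`, so they vanish. The index `3` is where `4 ≤ n` enters. -/
theorem sq_eq_zero_of_map_eq_deform (hn : 4 ≤ n) (x : R) (hx : x ^ 3 = 0)
    (he : Ideal.Quotient.mk (Ideal.span {x ^ 2}) x * Ideal.Quotient.mk (Ideal.span {x ^ 2}) x = 0)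
    (A : BasedAlg n R)
    (hA : A.map (Ideal.Quotient.mk (Ideal.span {x ^ 2})) =
      deform n (Ideal.Quotient.mk (Ideal.span {x ^ 2}) x) he (obstructed n _) obstructed_comm
        obstructed_zero) : x ^ 2 = 0 := by
  have hc (i j l : Fin n) (hi : i.val ≠ 0) (hj : j.val ≠ 0) :
      ∃ t, A.c i j l = x * obstructed n R i j l + x ^ 2 * t := by
    have h := congrFun (congrFun (congrFun (congrArg BasedAlg.c hA) i) j) l
    have h2 : obstructed n (R ⧸ Ideal.span {x ^ 2}) i j l =
        Ideal.Quotient.mk _ (obstructed n R i j l) := by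
      simp only [obstructed]; split_ifs <;> simp
    simp only [map_c, deform, hi, hj, if_false, h2, ← _root_.map_mul] at h
    rw [Ideal.Quotient.eq, Ideal.mem_span_singleton] at h
    obtain ⟨t, ht⟩ := h
    exact ⟨t, by linear_combination ht⟩
  have hc0 (i j l : Fin n) (hi : i.val = 0) (hjl : j ≠ l) : ∃ t, A.c i j l = x ^ 2 * t := by
    have h := congrFun (congrFun (congrFun (congrArg BasedAlg.c hA) i) j) l
    simp only [map_c, deform, hi, hjl, if_true, if_false] at h
    rwa [Ideal.Quotient.eq_zero_iff_mem, Ideal.mem_span_singleton] at h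
  -- The index `i = 0` has to be allowed, because the sums over `m` include the identity vector; `j
  -- ≠ l` avoids its constant `1`.
  have hx3 (i j l : Fin n) (hj : j.val ≠ 0) (hjl : j ≠ l) : ∃ s, A.c i j l = x * s := by
    by_cases hi : i.val = 0
    · obtain ⟨t, ht⟩ := hc0 i j l hi hjl
      exact ⟨x * t, by rw [ht]; ring⟩
    · obtain ⟨t, ht⟩ := hc i j l hi hj
      exact ⟨obstructed n R i j l + x * t, by rw [ht]; ring⟩
  let a : Fin n := ⟨1, by omega⟩
  let b : Fin n := ⟨2, by omega⟩
  let c : Fin n := ⟨3, by omega⟩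
  have key := A.assoc a a b c
  rw [Finset.sum_eq_single b, Finset.sum_eq_zero] at key
  · obtain ⟨s, hs⟩ := hc a a b (by simp [a]) (by simp [a])
    obtain ⟨t, ht⟩ := hc b b c (by simp [b]) (by simp [b])
    rw [hs, ht] at key
    simp only [obstructed, a, b, c] at key
    simp only [and_self, true_or, or_true, if_true] at key
    linear_combination key - (s + t + x * s * t) * hx
  · intro m _
    obtain ⟨s, hs⟩ := hc a b m (by simp [a]) (by simp [b])
    obtain ⟨t, ht⟩ := hx3 m a c (by simp [a]) (by simp [a, c])
    rw [hs, A.comm a m c, ht, obstructed, if_neg (by simp [a, b])]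
    linear_combination s * t * hx
  · intro m _ hm
    obtain ⟨s, hs⟩ := hc a a m (by simp [a]) (by simp [a])
    obtain ⟨t, ht⟩ := hx3 m b c (by simp [b]) (by simp [b, c])
    have : ¬ m.val = 2 := fun h => hm (Fin.ext h)
    rw [hs, ht, obstructed, if_neg (by simp [a, this])]
    linear_combination s * t * hx
  · simp

end Obstruction

section Smooth

variable {n : ℕ} {k : Type u} [CommRing k] [Nontrivial k]

/-- There is a first order deformation of the square-zero algebra which is obstructed. -/
theorem exists_obstruction (k : Type u) [CommRing k] [Nontrivial k] (hn : 4 ≤ n) :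
    ∃ (R : Type u) (_ : CommRing R) (_ : Algebra k R) (I : Ideal R) (_ : I ^ 2 = ⊥)
      (A : BasedAlg n (R ⧸ I)), A.IsUnital ∧
        ∀ B : BasedAlg n R, B.map (Ideal.Quotient.mk I) ≠ A := by
  -- The extension is `k[X]/(X³) → k[X]/(X²)`; its kernel `(x²)` is nonzero and has square zero
  -- because `x⁴ = 0`.
  let J : Ideal k[X] := Ideal.span {X ^ 3}
  let x : k[X] ⧸ J := Ideal.Quotient.mk J X
  have hx : x ^ 3 = 0 := by
    rw [← map_pow, Ideal.Quotient.eq_zero_iff_mem]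
    exact Ideal.mem_span_singleton_self _
  have hx2 : x ^ 2 ≠ 0 := by
    rw [← map_pow, Ne, Ideal.Quotient.eq_zero_iff_mem, Ideal.mem_span_singleton,
      X_pow_dvd_iff]
    intro h
    simpa using h 2 (by omega)
  have he : Ideal.Quotient.mk (Ideal.span {x ^ 2}) x * Ideal.Quotient.mk (Ideal.span {x ^ 2}) x
      = 0 := by
    rw [← _root_.map_mul, Ideal.Quotient.eq_zero_iff_mem, ← sq]
    exact Ideal.mem_span_singleton_self _
  refine ⟨k[X] ⧸ J, inferInstance, inferInstance, Ideal.span {x ^ 2}, ?_,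
    deform n _ he (obstructed n _) obstructed_comm obstructed_zero, fun _ => rfl, fun B hB =>
    hx2 (sq_eq_zero_of_map_eq_deform hn x hx he B hB)⟩
  rw [Ideal.span_singleton_pow, Ideal.span_singleton_eq_bot]
  linear_combination x * hx

theorem not_formallySmooth_coordRing1 (hn : 4 ≤ n) :
    ¬ Algebra.FormallySmooth k (k ⊗[ℤ] CoordRing1 n) := by
  intro h
  obtain ⟨R, _, _, I, hI, A, hA, hB⟩ := exists_obstruction k hn
  obtain ⟨g, hg⟩ := Algebra.FormallySmooth.comp_surjective k (k ⊗[ℤ] CoordRing1 n) I hI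
    (classify1k k A hA)
  refine hB ((univ1k n k).map g.toRingHom) ?_
  rw [← univ1k_map_classify1k (k := k) A hA, ← hg]
  rfl

theorem not_formallySmooth_coordRing (hn : 4 ≤ n) :
    ¬ Algebra.FormallySmooth k (k ⊗[ℤ] CoordRing n) := by
  intro h
  obtain ⟨R, _, _, I, hI, A, hA, hB⟩ := exists_obstruction k hn
  obtain ⟨g, hg⟩ := Algebra.FormallySmooth.comp_surjective k (k ⊗[ℤ] CoordRing n) I hI
    (classifyk k A)
  refine hB ((univk n k).map g.toRingHom) ?_
  rw [← univk_map_classifyk (k := k) A, ← hg]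
  rfl

end Smooth

theorem smooth_specMap_algebraMap_iff (R S : Type u) [CommRing R] [CommRing S] [Algebra R S] :
    Smooth (Spec.map (CommRingCat.ofHom (algebraMap R S))) ↔ Algebra.Smooth R S := by
  rw [HasRingHomProperty.Spec_iff (P := @Smooth)]
  exact RingHom.smooth_algebraMap

theorem smooth_tfae (n : ℕ) (k : Type u) [Field k] :
    List.TFAE [n ≤ 3, Smooth (B1kStr n k), Smooth (BkStr n k)] := by
  have h1 : Smooth (B1kStr n k) ↔ Algebra.Smooth k (k ⊗[ℤ] CoordRing1 n) :=
    smooth_specMap_algebraMap_iff k (k ⊗[ℤ] CoordRing1 n)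
  have h2 : Smooth (BkStr n k) ↔ Algebra.Smooth k (k ⊗[ℤ] CoordRing n) :=
    smooth_specMap_algebraMap_iff k (k ⊗[ℤ] CoordRing n)
  rw [h1, h2]
  tfae_have 1 → 2 := fun hn => by
    have := smooth_coordRing1 hn
    infer_instance
  tfae_have 1 → 3 := fun hn => by
    have := smooth_coordRing hn
    infer_instance
  tfae_have 2 → 1 := fun h => by
    by_contra hn
    exact not_formallySmooth_coordRing1 (by omega) h.formallySmooth
  tfae_have 3 → 1 := fun h => by
    by_contra hn
    exact not_formallySmooth_coordRing (by omega) h.formallySmooth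
  tfae_finish

end ModuliAlg

/-! ### A criterion computing cotangent spaces -/

namespace ModuliAlg

open BasedAlg

section Cotangent

open IsLocalRing

/-- If elements `y` generate a prime ideal `P` modulo `P ^ 2`, and are separated by tangent vectors,
then they give a basis of the cotangent space at `P`. -/
theorem finrank_cotangentSpace_of_dualNumber {A B K ι : Type*} [CommRing A] [CommRing B]
    [IsLocalRing B] [Algebra A B] [Field K] [Fintype ι] [DecidableEq ι] (P : Ideal A) [P.IsPrime]
    [IsLocalization.AtPrime B P] (y : ι → A) (hyP : ∀ s, y s ∈ P)
    (hP : P ≤ Ideal.span (Set.range y) ⊔ P ^ 2) (f : ι → A →+* DualNumber K)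
    (hf : ∀ t a, TrivSqZeroExt.fst (f t a) = 0 ↔ a ∈ P)
    (hfy : ∀ t s, f t (y s) = if s = t then DualNumber.eps else 0) :
    Module.finrank (ResidueField B) (CotangentSpace B) = Fintype.card ι := by
  have hmax : Ideal.map (algebraMap A B) P = maximalIdeal B :=
    IsLocalization.AtPrime.map_eq_maximalIdeal P B
  have hu (t : ι) (a : P.primeCompl) : IsUnit (f t a) := by
    rw [TrivSqZeroExt.isUnit_iff_isUnit_fst, isUnit_iff_ne_zero, Ne, hf]
    exact a.2
  -- Elements outside `P` have nonzero reduction under `f t`, so the tangent vector extends to the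
  -- localization.
  let F (t : ι) : B →+* DualNumber K := IsLocalization.lift (M := P.primeCompl) (hu t)
  have hF (t : ι) (a : A) : F t (algebraMap A B a) = f t a := IsLocalization.lift_eq _ _
  have hF0 (t : ι) {b : B} (hb : b ∈ maximalIdeal B) : TrivSqZeroExt.fst (F t b) = 0 := by
    have : maximalIdeal B ≤
        RingHom.ker ((TrivSqZeroExt.fstHom K K K).toRingHom.comp (F t)) := by
      rw [← hmax, Ideal.map_le_iff_le_comap]
      intro a ha
      change TrivSqZeroExt.fst (F t (algebraMap A B a)) = 0
      rw [hF, hf]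
      exact ha
    exact this hb
  have hF1 (t : ι) {b : B} (hb : TrivSqZeroExt.fst (F t b) = 0) : b ∈ maximalIdeal B := by
    rw [mem_maximalIdeal, mem_nonunits_iff]
    intro hu
    have := (hu.map (F t)).map (TrivSqZeroExt.fstHom K K K).toRingHom
    exact this.ne_zero hb
  have hF2 (t : ι) {b : B} (hb : b ∈ maximalIdeal B ^ 2) : F t b = 0 := by
    have : maximalIdeal B ^ 2 ≤ RingHom.ker (F t) := by
      rw [sq, Ideal.mul_le]
      intro r hr s hs
      rw [RingHom.mem_ker, _root_.map_mul]
      ext <;> simp [hF0 t hr, hF0 t hs]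
    exact this hb
  let z (s : ι) : maximalIdeal B :=
    ⟨algebraMap A B (y s), hmax ▸ Ideal.mem_map_of_mem _ (hyP s)⟩
  let v (s : ι) : CotangentSpace B := (maximalIdeal B).toCotangent (z s)
  have hv (g : ι → B) : ∑ s, residue B (g s) • v s =
      (maximalIdeal B).toCotangent (∑ s, g s • z s) := by
    rw [map_sum]
    refine Finset.sum_congr rfl fun s _ => ?_
    rw [map_smul]
    rfl
  have hz (g : ι → B) : ((∑ s, g s • z s : maximalIdeal B) : B) =
      ∑ s, g s * algebraMap A B (y s) := by
    rw [AddSubmonoidClass.coe_finsetSum]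
    rfl
  have hli : LinearIndependent (ResidueField B) v := by
    rw [Fintype.linearIndependent_iff]
    intro g hg t
    choose b hb using fun s => residue_surjective (g s)
    simp only [← hb] at hg
    rw [hv, Ideal.toCotangent_eq_zero, hz] at hg
    -- A relation modulo the square of the maximal ideal is killed by `F t`, which leaves only the
    -- `t`-th coefficient times `ε`; that coefficient therefore lies in the maximal ideal.
    have := hF2 t hg
    rw [map_sum, Finset.sum_eq_single t] at this
    · rw [_root_.map_mul, hF, hfy, if_pos rfl] at this
      have := congrArg TrivSqZeroExt.snd this
      simp at this
      rw [← hb, residue_eq_zero_iff]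
      exact hF1 t this
    · intro s _ hs
      rw [_root_.map_mul, hF, hfy, if_neg hs, mul_zero]
    · simp
  have hsp : ⊤ ≤ Submodule.span (ResidueField B) (Set.range v) := by
    rintro x -
    obtain ⟨⟨x, hx⟩, rfl⟩ := Ideal.toCotangent_surjective _ x
    have hx' := hx
    have : maximalIdeal B ≤ Ideal.span (Set.range (fun s => algebraMap A B (y s))) ⊔
        maximalIdeal B ^ 2 := by
      conv_lhs => rw [← hmax]
      refine (Ideal.map_mono hP).trans ?_
      rw [Ideal.map_sup, Ideal.map_pow, hmax, Ideal.map_span, ← Set.range_comp]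
      rfl
    obtain ⟨p, hp, q, hq, hpq⟩ := Submodule.mem_sup.1 (this hx')
    obtain ⟨g, hg⟩ := (Ideal.mem_span_range_iff_exists_fun).1 hp
    have : (maximalIdeal B).toCotangent ⟨x, hx⟩ = ∑ s, residue B (g s) • v s := by
      rw [hv, Ideal.toCotangent_eq, hz, hg]
      rwa [show x - p = q by rw [← hpq, add_sub_cancel_left]]
    rw [this]
    exact Submodule.sum_mem _ fun s _ => Submodule.smul_mem _ _ (Submodule.subset_span ⟨s, rfl⟩)
  rw [Module.finrank_eq_card_basis (Module.Basis.mk hli hsp)]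

theorem finrank_tangentSpace_spec (R : CommRingCat.{u}) (x : Spec R) {K ι : Type*} [Field K]
    [Fintype ι] [DecidableEq ι] (y : ι → R) (hyP : ∀ s, y s ∈ x.asIdeal)
    (hP : x.asIdeal ≤ Ideal.span (Set.range y) ⊔ x.asIdeal ^ 2) (f : ι → R →+* DualNumber K)
    (hf : ∀ t a, TrivSqZeroExt.fst (f t a) = 0 ↔ a ∈ x.asIdeal)
    (hfy : ∀ t s, f t (y s) = if s = t then DualNumber.eps else 0) :
    Module.finrank (IsLocalRing.ResidueField ((Spec R).presheaf.stalk x))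
      (TangentSpace (Spec R) x) = Fintype.card ι := by
  refine Subspace.dual_finrank_eq.trans ?_
  let _ : Algebra R ((Spec R).presheaf.stalk x) := StructureSheaf.stalkAlgebra R x
  have : x.asIdeal.IsPrime := PrimeSpectrum.isPrime x
  have : IsLocalization.AtPrime ((Spec R).presheaf.stalk x) x.asIdeal :=
    StructureSheaf.IsLocalization.to_stalk R x
  exact finrank_cotangentSpace_of_dualNumber x.asIdeal y hyP hP f hf hfy

end Cotangent

end ModuliAlg

/-! ### The tangent space at the square-zero algebra -/

namespace ModuliAlg

open BasedAlg

section Tangent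

variable (n : ℕ) (k : Type u) [Field k]

theorem map_squareZero {R S : Type*} [CommRing R] [CommRing S] (f : R →+* S) :
    (squareZero n R).map f = squareZero n S := by
  ext i j l
  · simp only [map_c, squareZero]
    split_ifs <;> simp
  · simp only [map_d, squareZero]
    split_ifs <;> simp

theorem univ1k_map_bulletHom : (univ1k n k).map (bulletHom n k).toRingHom = squareZero n k := by
  have : (bulletHom n k).toRingHom.comp Algebra.TensorProduct.includeRight.toRingHom =
      (squareZero n k).classify1 squareZero_isUnital := by
    refine RingHom.ext fun x => ?_
    refine (Algebra.TensorProduct.lift_tmul _ _ (fun _ _ => Commute.all _ _) _ _).trans ?_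
    rw [map_one, _root_.one_mul]
    rfl
  rw [univ1k, BasedAlg.map_map, this, univ1_map_classify1]

theorem bulletHom_c (i j l : Fin n) :
    bulletHom n k ((univ1k n k).c i j l) = (squareZero n k).c i j l := by
  rw [← univ1k_map_bulletHom]; rfl

theorem bullet_asIdeal : PrimeSpectrum.asIdeal (R := k ⊗[ℤ] CoordRing1 n) (bullet n k) =
    RingHom.ker (bulletHom n k) := by
  change Ideal.comap (bulletHom n k).toRingHom (IsLocalRing.maximalIdeal k) = _
  rw [(IsLocalRing.isField_iff_maximalIdeal_eq).1 (Field.toIsField k)]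
  rfl

/-- The structure constants for products of basis vectors other than the identity, expressed in
basis vectors other than the identity. -/
def BasedAlg.nonunitConst {m : ℕ} {R : Type*} [CommRing R] (A : BasedAlg (m + 1) R)
    (s : Sym2 (Fin m) × Fin m) : R :=
  Sym2.lift ⟨fun i j => A.c i.succ j.succ s.2.succ,
    fun i j => A.comm i.succ j.succ s.2.succ⟩ s.1

theorem BasedAlg.nonunitConst_mk {m : ℕ} {R : Type*} [CommRing R] (A : BasedAlg (m + 1) R)
    (i j l : Fin m) : A.nonunitConst (s(i, j), l) = A.c i.succ j.succ l.succ := rfl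

theorem nonunitConst_mem (m : ℕ) (s : Sym2 (Fin m) × Fin m) :
    (univ1k (m + 1) k).nonunitConst s ∈ RingHom.ker (bulletHom (m + 1) k) := by
  obtain ⟨s, l⟩ := s
  induction s using Sym2.ind with
  | _ i j =>
    rw [nonunitConst_mk, RingHom.mem_ker, bulletHom_c]
    simp [squareZero]

/-- The coefficient of the identity vanishes to second order at the square-zero algebra. -/
theorem BasedAlg.IsUnital.c_succ_succ_zero_mem_sq {m : ℕ} {A : Type*} [CommRing A]
    {U : BasedAlg (m + 1) A} (hU : U.IsUnital) (hm : 2 ≤ m) (P : Ideal A)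
    (hP : ∀ i j l : Fin m, U.c i.succ j.succ l.succ ∈ P) (i j : Fin m) :
    U.c i.succ j.succ 0 ∈ P ^ 2 := by
  obtain ⟨p, hp⟩ : ∃ p : Fin m, p ≠ i := by
    have : Nontrivial (Fin m) := Fin.nontrivial_iff_two_le.2 hm
    exact exists_ne i
  -- The coefficient of `e_p` in `(e_i e_j) e_p = e_i (e_j e_p)`: the identity part of `e_i e_j`
  -- appears alone on the left, while `p ≠ i` removes the identity term on the right. All that
  -- remains are products of two elements of `P`.
  have h := U.assoc i.succ j.succ p.succ p.succ
  rw [Fin.sum_univ_succ, Fin.sum_univ_succ, hU.c_zero (i := 0) rfl, if_pos rfl, mul_one,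
    hU.c_zero_right (j := 0) rfl, if_neg (by simpa using hp.symm), mul_zero, zero_add,
    ← eq_sub_iff_add_eq] at h
  rw [h, sq]
  exact Ideal.sub_mem _ (Ideal.sum_mem _ fun a _ => Ideal.mul_mem_mul (hP _ _ _) (hP _ _ _))
    (Ideal.sum_mem _ fun a _ => Ideal.mul_mem_mul (hP _ _ _) (hP _ _ _))

/-- Modulo `J` all products of nonidentity basis vectors vanish, so `U` becomes the square-zero
algebra. By uniqueness the quotient map factors through `β`, whence `ker β` maps to zero. -/
theorem ker_le_of_map_eq_squareZero {m : ℕ} {A : Type u} [CommRing A] [Algebra k A]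
    {U : BasedAlg (m + 1) A} (hU : U.IsUnital) (hm : 2 ≤ m) (β : A →ₐ[k] k)
    (hβ : U.map β.toRingHom = squareZero (m + 1) k)
    (hext : ∀ {R : Type u} [CommRing R] [Algebra k R] {f g : A →ₐ[k] R},
      U.map f.toRingHom = U.map g.toRingHom → f = g) :
    RingHom.ker β ≤ Ideal.span (Set.range U.nonunitConst) ⊔ RingHom.ker β ^ 2 := by
  set J := Ideal.span (Set.range U.nonunitConst) ⊔ RingHom.ker β ^ 2 with hJ
  have hker (i j l : Fin m) : U.c i.succ j.succ l.succ ∈ RingHom.ker β := by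
    have := congrFun (congrFun (congrFun (congrArg BasedAlg.c hβ) i.succ) j.succ) l.succ
    rw [map_c] at this
    exact this.trans (by simp [squareZero])
  have h : Ideal.Quotient.mkₐ k J = (Algebra.ofId k (A ⧸ J)).comp β := by
    refine hext ?_
    have : U.map ((Algebra.ofId k (A ⧸ J)).comp β).toRingHom = squareZero (m + 1) (A ⧸ J) := by
      rw [← map_squareZero (m + 1) (Algebra.ofId k (A ⧸ J)).toRingHom, ← hβ]
      rfl
    rw [this]
    have hu := hU.map (Ideal.Quotient.mkₐ k J).toRingHom
    ext i j l
    · by_cases hi : i.val = 0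
      · rw [hu.c_zero hi, squareZero_isUnital.c_zero hi]
      by_cases hj : j.val = 0
      · rw [hu.c_zero_right hj, squareZero_isUnital.c_zero_right hj]
      have hz : (squareZero (m + 1) (A ⧸ J)).c i j l = 0 := by
        simp only [squareZero, hi, hj, if_false]
      rw [hz, map_c]
      refine Ideal.Quotient.eq_zero_iff_mem.2 ?_
      obtain ⟨i, rfl⟩ := Fin.exists_succ_eq.2 (fun h => hi (by simp [h]) : i ≠ 0)
      obtain ⟨j, rfl⟩ := Fin.exists_succ_eq.2 (fun h => hj (by simp [h]) : j ≠ 0)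
      cases l using Fin.cases with
      | zero => exact Ideal.mem_sup_right (hU.c_succ_succ_zero_mem_sq hm _ hker i j)
      | succ l => exact Ideal.mem_sup_left (Ideal.subset_span ⟨(s(i, j), l), rfl⟩)
    · rw [hu, squareZero_isUnital]
  intro a ha
  have := DFunLike.congr_fun h a
  rw [AlgHom.comp_apply, show β a = 0 from ha, map_zero] at this
  exact Ideal.Quotient.eq_zero_iff_mem.1 this

open Classical in
/-- The structure constants of a tangent vector at the square-zero algebra. -/
noncomputable def tangentConst {m : ℕ} (s : Sym2 (Fin m) × Fin m) (i j l : Fin (m + 1)) :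
    DualNumber k :=
  if ∃ i' j' l', i = Fin.succ i' ∧ j = Fin.succ j' ∧ l = Fin.succ l' ∧ s = (s(i', j'), l')
    then 1 else 0

/-- A tangent vector at the square-zero algebra. -/
noncomputable def tangentAlg {m : ℕ} (s : Sym2 (Fin m) × Fin m) :
    BasedAlg (m + 1) (DualNumber k) :=
  deform (m + 1) DualNumber.eps DualNumber.eps_mul_eps (tangentConst k s)
    (fun i j l => by
      simp only [tangentConst]
      congr 1
      refine propext ⟨?_, ?_⟩ <;>
        exact fun ⟨i', j', l', h1, h2, h3, h4⟩ => ⟨j', i', l', h2, h1, h3, by rw [h4, Sym2.eq_swap]⟩)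
    (fun i j l hl => if_neg (by
      rintro ⟨i', j', l', -, -, rfl, -⟩
      simp at hl))

theorem tangentAlg_isUnital {m : ℕ} (s : Sym2 (Fin m) × Fin m) : (tangentAlg k s).IsUnital :=
  fun _ => rfl

theorem fst_classify1k_tangentAlg {m : ℕ} (s : Sym2 (Fin m) × Fin m)
    (a : k ⊗[ℤ] CoordRing1 (m + 1)) :
    TrivSqZeroExt.fst (classify1k k (tangentAlg k s) (tangentAlg_isUnital k s) a) =
      bulletHom (m + 1) k a := by
  have : (TrivSqZeroExt.fstHom k k k).comp
      (classify1k k (tangentAlg k s) (tangentAlg_isUnital k s)) = bulletHom (m + 1) k := by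
    refine algHom_ext1k ?_
    rw [univ1k_map_bulletHom]
    change ((univ1k (m + 1) k).map (classify1k k (tangentAlg k s)
      (tangentAlg_isUnital k s)).toRingHom).map (TrivSqZeroExt.fstHom k k k).toRingHom = _
    rw [univ1k_map_classify1k]
    ext i j l
    · simp only [map_c, tangentAlg, deform, squareZero]
      split_ifs <;> simp
    · simp only [map_d, tangentAlg, deform, squareZero]
      split_ifs <;> simp
  exact DFunLike.congr_fun this a

theorem classify1k_tangentAlg_nonunitConst {m : ℕ} [DecidableEq (Sym2 (Fin m) × Fin m)]
    (t s : Sym2 (Fin m) × Fin m) :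
    classify1k k (tangentAlg k t) (tangentAlg_isUnital k t) ((univ1k (m + 1) k).nonunitConst s) =
      if s = t then DualNumber.eps else 0 := by
  obtain ⟨s, l⟩ := s
  induction s using Sym2.ind with
  | _ i j =>
    have h : classify1k k (tangentAlg k t) (tangentAlg_isUnital k t)
        ((univ1k (m + 1) k).nonunitConst (s(i, j), l)) = (tangentAlg k t).c i.succ j.succ l.succ := by
      rw [nonunitConst_mk]
      conv_rhs => rw [← univ1k_map_classify1k (k := k) (tangentAlg k t) (tangentAlg_isUnital k t)]
      rfl
    refine h.trans ?_
    have hiff : (∃ i' j' l', i.succ = Fin.succ i' ∧ j.succ = Fin.succ j' ∧ l.succ = Fin.succ l' ∧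
        t = (s(i', j'), l')) ↔ (s(i, j), l) = t := by
      constructor
      · rintro ⟨i', j', l', h1, h2, h3, rfl⟩
        rw [Fin.succ_injective _ h1, Fin.succ_injective _ h2, Fin.succ_injective _ h3]
      · rintro rfl
        exact ⟨i, j, l, rfl, rfl, rfl, rfl⟩
    have he : (tangentAlg k t).c i.succ j.succ l.succ =
        DualNumber.eps * tangentConst k t i.succ j.succ l.succ := by
      simp [tangentAlg, deform]
    rw [he, tangentConst]
    by_cases h : (s(i, j), l) = t
    · rw [if_pos (hiff.2 h), mul_one]
      exact (if_pos h).symm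
    · rw [if_neg (fun h' => h (hiff.1 h')), mul_zero]
      exact (if_neg h).symm

theorem finrank_tangentSpace_bullet (hn : 3 ≤ n) :
    Module.finrank (IsLocalRing.ResidueField ((B1k n k).presheaf.stalk (bullet n k)))
      (TangentSpace (B1k n k) (bullet n k)) = n * (n - 1) ^ 2 / 2 := by
  classical
  obtain ⟨m, rfl⟩ : ∃ m, n = m + 1 := ⟨n - 1, by omega⟩
  have hker := bullet_asIdeal (m + 1) k
  refine (finrank_tangentSpace_spec (.of (k ⊗[ℤ] CoordRing1 (m + 1))) (bullet (m + 1) k)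
    (K := k) (univ1k (m + 1) k).nonunitConst (fun s => ?_) ?_
    (fun t => (classify1k k (tangentAlg k t) (tangentAlg_isUnital k t)).toRingHom)
    (fun t a => ?_) (fun t s => classify1k_tangentAlg_nonunitConst k t s)).trans ?_
  · exact hker ▸ nonunitConst_mem k m s
  · exact hker ▸ ker_le_of_map_eq_squareZero k (univ1k_isUnital _ k) (by omega) _ (univ1k_map_bulletHom _ k) algHom_ext1k
  · have h : a ∈ RingHom.ker (bulletHom (m + 1) k) ↔ bulletHom (m + 1) k a = 0 := Iff.rfl
    rw [← fst_classify1k_tangentAlg k t a] at h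
    exact hker ▸ h.symm
  -- The unordered pairs of the `m = n - 1` nonidentity vectors number `n(n-1)/2`, and each has `n -
  -- 1` free coefficients.
  · rw [Fintype.card_prod, Sym2.card, Fintype.card_fin, Nat.choose_two_right, Nat.add_sub_cancel,
      ← Nat.mul_div_right_comm]
    · congr 1; ring
    · exact (Nat.even_mul_pred_self (m + 1)).two_dvd

end Tangent

end ModuliAlg

/-! ### Nonzero discriminant over an algebraically closed field -/

namespace ModuliAlg

open BasedAlg Matrix

namespace BasedAlg

variable {n : ℕ} {R : Type*} [CommRing R]

/-- The free module underlying a based algebra, which carries its ring structure. -/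
def Carrier (_ : BasedAlg n R) : Type _ := Fin n → R

noncomputable instance (A : BasedAlg n R) : AddCommGroup A.Carrier :=
  inferInstanceAs (AddCommGroup (Fin n → R))

noncomputable instance (A : BasedAlg n R) : Module R A.Carrier :=
  inferInstanceAs (Module R (Fin n → R))

instance (A : BasedAlg n R) : Module.Finite R A.Carrier :=
  inferInstanceAs (Module.Finite R (Fin n → R))

noncomputable instance (A : BasedAlg n R) : CommRing A.Carrier where
  __ : AddCommGroup A.Carrier := inferInstance
  mul x y := A.mul x y
  one := A.d
  mul_assoc := A.mul_assoc
  mul_comm := A.mul_comm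
  one_mul := A.d_mul
  mul_one := A.mul_d
  left_distrib x := (A.mul x).map_add
  right_distrib x y z := LinearMap.map_add₂ A.mul x y z
  zero_mul x := LinearMap.map_zero₂ A.mul x
  mul_zero x := (A.mul x).map_zero

noncomputable instance (A : BasedAlg n R) : Algebra R A.Carrier :=
  Algebra.ofModule (fun r x y => LinearMap.map_smul₂ A.mul r x y)
    fun r x y => (A.mul x).map_smul r y

theorem trace_mul (A : BasedAlg n R) (v : Fin n → R) :
    LinearMap.trace R (Fin n → R) (A.mul v) = ∑ l, v l * ∑ m, A.c l m m := by
  rw [LinearMap.trace_eq_matrix_trace R (Pi.basisFun R (Fin n)), Matrix.trace]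
  simp only [diag_apply, LinearMap.toMatrix_apply, Pi.basisFun_apply, Pi.basisFun_repr,
    mul_single_right_apply]
  rw [Finset.sum_comm]
  simp only [Finset.mul_sum]

theorem traceForm_mulVec (A : BasedAlg n R) (x : Fin n → R) (i : Fin n) :
    ((of fun i j => ∑ l, A.c i j l * ∑ m, A.c l m m) *ᵥ x) i =
      LinearMap.trace R (Fin n → R) (A.mul (A.mul (Pi.single i 1) x)) := by
  rw [trace_mul]
  simp only [mul_single_left_apply, mulVec, dotProduct, of_apply, Finset.sum_mul]
  rw [Finset.sum_comm]
  exact Finset.sum_congr rfl fun l _ => Finset.sum_congr rfl fun m _ => by ring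

/-- If `x` is nilpotent, so is every `e_i x`, which then has trace zero. Thus `x` lies in the
radical of the nondegenerate trace form. -/
theorem isReduced_of_disc_ne_zero {K : Type*} [Field K] (A : BasedAlg n K) (h : A.disc ≠ 0) :
    _root_.IsReduced A.Carrier := by
  refine ⟨fun x hx => ?_⟩
  refine Matrix.eq_zero_of_mulVec_eq_zero h (v := x) ?_
  ext i
  let s : A.Carrier := (Pi.single i 1 : Fin n → K)
  have hn : IsNilpotent (s * x) := (Commute.all _ _).isNilpotent_mul_left hx
  refine (A.traceForm_mulVec x i).trans ?_
  exact (LinearMap.isNilpotent_trace_of_isNilpotent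
    (hn.map (Algebra.lmul K A.Carrier))).eq_zero

/-- A based algebra isomorphic to a product algebra is given by an invertible matrix. -/
theorem eq_ofMatrix_of_algEquiv (A : BasedAlg n R) (E : A.Carrier ≃ₐ[R] (Fin n → R)) :
    ∃ M : (Matrix (Fin n) (Fin n) R)ˣ, A = ofMatrix M ∧ M.1 *ᵥ A.d = 1 := by
  let E' : (Fin n → R) ≃ₗ[R] (Fin n → R) := E.toLinearEquiv
  let M : (Matrix (Fin n) (Fin n) R)ˣ :=
    ⟨LinearMap.toMatrix' E'.toLinearMap, LinearMap.toMatrix' E'.symm.toLinearMap,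
      by rw [← LinearMap.toMatrix'_comp]; simp, by rw [← LinearMap.toMatrix'_comp]; simp⟩
  have hM (x : Fin n → R) : M.1 *ᵥ x = E' x := LinearMap.toMatrix'_mulVec _ _
  have hMi (x : Fin n → R) : (M⁻¹).1 *ᵥ x = E'.symm x := LinearMap.toMatrix'_mulVec _ _
  have h1 : E' A.d = 1 := map_one E
  refine ⟨M, ext_mul (LinearMap.ext fun x => LinearMap.ext fun y => ?_) ?_, (hM _).trans h1⟩
  · have hE (x y : A.Carrier) : E (x * y) = E x * E y := _root_.map_mul E x y
    have h : E' (A.mul x y) = E' x * E' y := hE x y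
    rw [mul_ofMatrix, hM, hM, hMi, ← h, LinearEquiv.symm_apply_apply]
  · rw [ofMatrix_d, hMi, ← h1, LinearEquiv.symm_apply_apply]

/-- A reduced Artinian ring is the product of its residue fields; these are finite over `K`, hence
equal to `K`, and counting dimensions gives `n` of them. -/
theorem exists_algEquiv_of_disc_ne_zero {K : Type*} [Field K] [IsAlgClosed K] (A : BasedAlg n K)
    (h : A.disc ≠ 0) : Nonempty (A.Carrier ≃ₐ[K] (Fin n → K)) := by
  have := A.isReduced_of_disc_ne_zero h
  have : IsArtinianRing A.Carrier := IsArtinianRing.of_finite K A.Carrier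
  let e₁ := (IsArtinianRing.equivPi A.Carrier).restrictScalars K
  have hb (I : MaximalSpectrum A.Carrier) :
      Function.Bijective (Algebra.ofId K (A.Carrier ⧸ I.asIdeal)) :=
    letI := Ideal.Quotient.field I.asIdeal
    IsAlgClosed.algebraMap_bijective_of_isIntegral
  let e₂ : (∀ I : MaximalSpectrum A.Carrier, A.Carrier ⧸ I.asIdeal) ≃ₐ[K]
      (MaximalSpectrum A.Carrier → K) :=
    AlgEquiv.piCongrRight fun I => (AlgEquiv.ofBijective _ (hb I)).symm
  have : Fintype (MaximalSpectrum A.Carrier) := Fintype.ofFinite _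
  have hc : Fintype.card (MaximalSpectrum A.Carrier) = n := by
    have h1 := (e₁.trans e₂).toLinearEquiv.finrank_eq
    rw [Module.finrank_fintype_fun_eq_card] at h1
    have h2 : Module.finrank K A.Carrier = n := Module.finrank_fin_fun K
    rw [← h1, h2]
  let e₃ : (MaximalSpectrum A.Carrier → K) ≃ₐ[K] (Fin n → K) :=
    AlgEquiv.piCongrLeft K (fun _ => K) (Fintype.equivFinOfCardEq hc)
  exact ⟨(e₁.trans e₂).trans e₃⟩

/-- A based algebra with nonzero discriminant over an algebraically closed field is the product
algebra with the basis given by an invertible matrix. -/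
theorem IsUnital.exists_eq_ofMatrix {K : Type*} [Field K] [IsAlgClosed K] {A : BasedAlg n K}
    (hA : A.IsUnital) (h : A.disc ≠ 0) :
    ∃ M : (Matrix (Fin n) (Fin n) K)ˣ, A = ofMatrix M ∧ ∀ i j : Fin n, j.val = 0 → M.1 i j = 1 := by
  obtain ⟨E⟩ := A.exists_algEquiv_of_disc_ne_zero h
  obtain ⟨M, hM, hd⟩ := A.eq_ofMatrix_of_algEquiv E
  refine ⟨M, hM, fun i j hj => ?_⟩
  have : A.d = Pi.single j 1 := by
    ext i
    rw [hA i, Pi.single_apply]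
    congr 1
    rw [Fin.ext_iff, hj]
  rw [this, mulVec_single_one] at hd
  exact congrFun hd i

end BasedAlg

end ModuliAlg

/-! ### The generic étale algebra -/

namespace ModuliAlg

open BasedAlg Matrix

section Generic

variable (m : ℕ) (k : Type u) [Field k]

/-- The generic matrix whose first column is constant with value `1`. -/
noncomputable def genMatrix :
    Matrix (Fin (m + 1)) (Fin (m + 1)) (MvPolynomial (Fin (m + 1) × Fin m) k) :=
  of fun i j => Fin.cases 1 (fun j => MvPolynomial.X (i, j)) j

/-- The coordinate ring of the scheme of invertible matrices with first column equal to `1`. -/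
abbrev GenRing : Type u := Localization.Away (genMatrix m k).det

/-- The universal invertible matrix with first column equal to `1`. -/
noncomputable def genUnit : (Matrix (Fin (m + 1)) (Fin (m + 1)) (GenRing m k))ˣ :=
  nonsingInvUnit ((algebraMap _ (GenRing m k)).mapMatrix (genMatrix m k)) (by
    rw [← RingHom.map_det]
    exact IsLocalization.Away.algebraMap_isUnit _)

theorem genUnit_val : (genUnit m k).1 = (algebraMap _ (GenRing m k)).mapMatrix (genMatrix m k) :=
  rfl

theorem genUnit_zero (i j : Fin (m + 1)) (hj : j.val = 0) : (genUnit m k).1 i j = 1 := by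
  obtain rfl : j = 0 := Fin.ext hj
  simp [genUnit_val, genMatrix]

theorem genUnit_succ (i : Fin (m + 1)) (j : Fin m) : (genUnit m k).1 i j.succ =
    algebraMap (MvPolynomial (Fin (m + 1) × Fin m) k) (GenRing m k) (MvPolynomial.X (i, j)) := by
  simp [genUnit_val, genMatrix]

variable {m k} in
theorem aeval_genMatrix {K : Type*} [CommRing K] [Algebra k K]
    (M : Matrix (Fin (m + 1)) (Fin (m + 1)) K) (hM : ∀ i j, j.val = 0 → M i j = 1) :
    (MvPolynomial.aeval (fun s : Fin (m + 1) × Fin m => M s.1 s.2.succ)).toRingHom.mapMatrix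
      (genMatrix m k) = M := by
  ext i j
  cases j using Fin.cases with
  | zero => simp [genMatrix, hM i 0 rfl]
  | succ j => simp [genMatrix]

variable {m k} in
theorem exists_algHom_genRing {K : Type*} [CommRing K] [Algebra k K]
    (M : (Matrix (Fin (m + 1)) (Fin (m + 1)) K)ˣ) (hM : ∀ i j, j.val = 0 → M.1 i j = 1) :
    ∃ g : GenRing m k →ₐ[k] K, (ofMatrix (genUnit m k)).map g.toRingHom = ofMatrix M := by
  let a : MvPolynomial (Fin (m + 1) × Fin m) k →ₐ[k] K :=
    MvPolynomial.aeval (fun s : Fin (m + 1) × Fin m => M.1 s.1 s.2.succ)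
  have ha : a.toRingHom.mapMatrix (genMatrix m k) = M.1 := aeval_genMatrix M.1 hM
  have hu : IsUnit (a.toRingHom (genMatrix m k).det) := by
    rw [RingHom.map_det, ha]
    exact (Matrix.isUnit_iff_isUnit_det _).1 M.isUnit
  let g' : GenRing m k →+* K := IsLocalization.Away.lift (genMatrix m k).det hu
  have hg' (x) : g' (algebraMap _ _ x) = a x := IsLocalization.Away.lift_eq _ hu x
  let g : GenRing m k →ₐ[k] K := ⟨g', fun r => by
    rw [IsScalarTower.algebraMap_apply k (MvPolynomial (Fin (m + 1) × Fin m) k) (GenRing m k)]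
    exact (hg' _).trans (a.commutes r)⟩
  refine ⟨g, ?_⟩
  rw [map_ofMatrix]
  congr 1
  refine Units.ext (Eq.trans ?_ ha)
  ext i j
  exact hg' _

/-- An invertible matrix with first column equal to `1`. -/
def oneColMatrix (m : ℕ) (R : Type*) [CommRing R] : Matrix (Fin (m + 1)) (Fin (m + 1)) R :=
  updateCol 1 0 1

theorem det_oneColMatrix (R : Type*) [CommRing R] : (oneColMatrix m R).det = 1 := by
  rw [oneColMatrix, ← Matrix.cramer_apply, Matrix.cramer_one]
  simp

theorem oneColMatrix_zero (R : Type*) [CommRing R] (i j : Fin (m + 1)) (hj : j.val = 0) :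
    oneColMatrix m R i j = 1 := by
  obtain rfl : j = 0 := Fin.ext hj
  simp [oneColMatrix]

/-- The generic matrix specializes to `oneColMatrix`, whose determinant is `1`. -/
theorem det_genMatrix_ne_zero : (genMatrix m k).det ≠ 0 := by
  intro h
  have := aeval_genMatrix (k := k) (oneColMatrix m k) (oneColMatrix_zero m k)
  have h1 := congrArg Matrix.det this
  rw [← RingHom.map_det, h, map_zero, det_oneColMatrix] at h1
  exact zero_ne_one h1

theorem powers_det_le :
    Submonoid.powers (genMatrix m k).det ≤
      nonZeroDivisors (MvPolynomial (Fin (m + 1) × Fin m) k) :=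
  powers_le_nonZeroDivisors_of_noZeroDivisors (det_genMatrix_ne_zero m k)

instance : IsDomain (GenRing m k) := IsLocalization.isDomain_localization (powers_det_le m k)

end Generic

/-- A unital based algebra which is universal among those over `k`-algebras. -/
structure IsUniversal (k : Type u) [Field k] {n : ℕ} {A : Type u} [CommRing A] [Algebra k A]
    (U : BasedAlg n A) : Prop where
  isUnital : U.IsUnital
  ext : ∀ {R : Type u} [CommRing R] [Algebra k R] {f g : A →ₐ[k] R},
    U.map f.toRingHom = U.map g.toRingHom → f = g
  exists_map : ∀ {R : Type u} [CommRing R] [Algebra k R] (B : BasedAlg n R), B.IsUnital →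
    ∃ f : A →ₐ[k] R, U.map f.toRingHom = B

theorem univ1k_isUniversal (n : ℕ) (k : Type u) [Field k] : IsUniversal k (univ1k n k) where
  isUnital := univ1k_isUnital n k
  ext := algHom_ext1k
  exists_map B hB := ⟨classify1k k B hB, univ1k_map_classify1k B hB⟩

section Universal

variable {m : ℕ} {k : Type u} [Field k] {A : Type u} [CommRing A] [Algebra k A]
  {U : BasedAlg (m + 1) A}

/-- Every étale point is a specialization of the generic one. -/
theorem IsUniversal.ker_le (hU : IsUniversal k U) {φ : A →ₐ[k] GenRing m k}
    (hφ : U.map φ.toRingHom = ofMatrix (genUnit m k)) (p : Ideal A) [p.IsPrime]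
    (hp : U.disc ∉ p) : RingHom.ker φ ≤ p := by
  -- A geometric point over `p`, with kernel exactly `p`. There the algebra splits and comes from a
  -- matrix, so `f` factors through `φ`.
  let f : A →ₐ[k] AlgebraicClosure p.ResidueField :=
    (IsScalarTower.toAlgHom k p.ResidueField (AlgebraicClosure p.ResidueField)).comp
      (IsScalarTower.toAlgHom k A p.ResidueField)
  have hf : RingHom.ker f.toRingHom = p := by
    ext x
    have : algebraMap p.ResidueField (AlgebraicClosure p.ResidueField)
        (algebraMap A p.ResidueField x) = 0 ↔ x ∈ p := by
      rw [map_eq_zero, Ideal.algebraMap_residueField_eq_zero]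
    exact this
  have hd : (U.map f.toRingHom).disc ≠ 0 := by
    rw [map_disc]
    intro h
    exact hp (hf ▸ h)
  obtain ⟨M, hM, hM1⟩ := (hU.isUnital.map f.toRingHom).exists_eq_ofMatrix hd
  obtain ⟨g, hg⟩ := exists_algHom_genRing (k := k) M hM1
  have : f = g.comp φ := hU.ext (by
    rw [hM, ← hg, ← hφ]
    rfl)
  intro x hx
  rw [← hf]
  change f x = 0
  rw [this, AlgHom.comp_apply, show φ x = 0 from hx, map_zero]

theorem disc_notMem_ker {φ : A →ₐ[k] GenRing m k}
    (hφ : U.map φ.toRingHom = ofMatrix (genUnit m k)) : U.disc ∉ RingHom.ker φ := by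
  intro h
  have h1 : (U.map φ.toRingHom).disc = 0 := by
    rw [map_disc]; exact h
  rw [hφ, disc_ofMatrix] at h1
  exact (((Matrix.isUnit_iff_isUnit_det _).1 (genUnit m k).isUnit).pow 2).ne_zero h1

end Universal

end ModuliAlg

/-! ### Degeneration to the square-zero algebra, and the étale component -/

namespace ModuliAlg

open BasedAlg Matrix

namespace BasedAlg

variable {n : ℕ} {R : Type*} [CommRing R] [IsDomain R]

/-- The based algebra obtained by multiplying the `i`-th basis vector with `w i`, if its structure
constants are still in `R`. -/
def rescale (A : BasedAlg n R) (w : Fin n → R) (hw : ∀ i, w i ≠ 0) (c : Fin n → Fin n → Fin n → R)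
    (d : Fin n → R) (hc : ∀ i j l, c i j l * w l = w i * w j * A.c i j l)
    (hd : ∀ i, d i * w i = A.d i) : BasedAlg n R where
  c := c
  d := d
  comm i j l := mul_right_cancel₀ (hw l) (by rw [hc, hc, A.comm]; ring)
  assoc i j l p := mul_right_cancel₀ (hw p) (by
    have h (i j l : Fin n) : (∑ m, c i j m * c m l p) * w p =
        w i * w j * w l * ∑ m, A.c i j m * A.c m l p := by
      rw [Finset.sum_mul, Finset.mul_sum]
      refine Finset.sum_congr rfl fun m _ => ?_
      linear_combination c i j m * hc m l p + w l * A.c m l p * hc i j m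
    have hcomm (i m p : Fin n) : c i m p = c m i p :=
      mul_right_cancel₀ (hw p) (by rw [hc, hc, A.comm]; ring)
    have h1 : ∑ m, c j l m * c i m p = ∑ m, c j l m * c m i p :=
      Finset.sum_congr rfl fun m _ => by rw [hcomm i]
    have h2 : ∑ m, A.c j l m * A.c i m p = ∑ m, A.c j l m * A.c m i p :=
      Finset.sum_congr rfl fun m _ => by rw [A.comm i]
    rw [h1, h i j l, h j l i, A.assoc i j l p, h2]
    ring)
  one_mul j l := mul_right_cancel₀ (hw l) (by
    have h : (∑ i, d i * c i j l) * w l = w j * ∑ i, A.d i * A.c i j l := by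
      rw [Finset.sum_mul, Finset.mul_sum]
      refine Finset.sum_congr rfl fun m _ => ?_
      linear_combination d m * hc m j l + w j * A.c m j l * hd m
    rw [h, A.one_mul]
    split_ifs with hjl
    · rw [hjl]; ring
    · ring)

/-- Rescaling multiplies row `i` of the trace form by `w i`, and likewise column `i`. -/
theorem disc_rescale (A : BasedAlg n R) (w : Fin n → R) (hw : ∀ i, w i ≠ 0) (c d hc hd) :
    (A.rescale w hw c d hc hd).disc = (∏ i, w i) * ((∏ i, w i) * A.disc) := by
  have ht (l : Fin n) : ∑ m, c l m m = w l * ∑ m, A.c l m m := by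
    rw [Finset.mul_sum]
    exact Finset.sum_congr rfl fun m _ => mul_right_cancel₀ (hw m) (by rw [hc]; ring)
  rw [disc, disc, ← Matrix.det_mul_row, ← Matrix.det_mul_column]
  congr 1
  ext i j
  simp only [of_apply, rescale, ht, Finset.mul_sum]
  refine Finset.sum_congr rfl fun l _ => Finset.sum_congr rfl fun m _ => ?_
  linear_combination A.c l m m * hc i j l

open Polynomial in
/-- The degeneration of a unital based algebra to the square-zero algebra. -/
noncomputable def degeneration {A : BasedAlg n R} (hA : A.IsUnital) : BasedAlg n R[X] :=
  (A.map C).rescale (fun i => if i.val = 0 then 1 else X)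
    (fun i => by split_ifs; exacts [one_ne_zero, X_ne_zero])
    -- With `e_i` replaced by `X e_i` for `i ≠ 0`, a product gains `X²`. One factor `X` is absorbed
    -- by `X e_l`, except for `l = 0`, where the basis vector is unscaled.
    (fun i j l => if i.val = 0 then (if j = l then 1 else 0)
      else if j.val = 0 then (if i = l then 1 else 0)
      else if l.val = 0 then X ^ 2 * C (A.c i j l) else X * C (A.c i j l))
    (fun i => if i.val = 0 then 1 else 0)
    (fun i j l => by
      by_cases hi : i.val = 0
      · rw [(hA.map C).c_zero hi]
        simp only [hi, if_true]
        split_ifs <;> simp_all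
      by_cases hj : j.val = 0
      · rw [(hA.map C).c_zero_right hj]
        simp only [hi, hj, if_true, if_false]
        split_ifs <;> simp_all
      simp only [hi, hj, if_false, map_c]
      split_ifs <;> ring)
    (fun i => by
      rw [hA.map C]
      split_ifs <;> simp)

theorem degeneration_isUnital {A : BasedAlg n R} (hA : A.IsUnital) :
    (degeneration hA).IsUnital := fun _ => rfl

theorem disc_degeneration_ne_zero {A : BasedAlg n R} (hA : A.IsUnital) (h : A.disc ≠ 0) :
    (degeneration hA).disc ≠ 0 := by
  rw [degeneration, disc_rescale, map_disc]
  have hw : ∏ i : Fin n, (if i.val = 0 then 1 else Polynomial.X : Polynomial R) ≠ 0 :=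
    Finset.prod_ne_zero_iff.2 fun i _ => by
      split_ifs; exacts [one_ne_zero, Polynomial.X_ne_zero]
  exact mul_ne_zero hw (mul_ne_zero hw (Polynomial.C_ne_zero.2 h))

theorem degeneration_map_zero {A : BasedAlg n R} (hA : A.IsUnital) :
    (degeneration hA).map (Polynomial.evalRingHom 0) = squareZero n R := by
  ext i j l
  · simp only [map_c, degeneration, rescale, squareZero]
    split_ifs <;> simp
  · simp only [map_d, degeneration, rescale, squareZero]
    split_ifs <;> simp

end BasedAlg

section Universal

variable {m : ℕ} {k : Type u} [Field k] {A : Type u} [CommRing A] [Algebra k A]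
  {U : BasedAlg (m + 1) A}

/-- The point of the square-zero algebra is a specialization of an étale point. -/
theorem IsUniversal.exists_le_ker (hU : IsUniversal k U) {β : A →ₐ[k] k}
    (hβ : U.map β.toRingHom = squareZero (m + 1) k) :
    ∃ p : Ideal A, p.IsPrime ∧ U.disc ∉ p ∧ p ≤ RingHom.ker β := by
  let M : (Matrix (Fin (m + 1)) (Fin (m + 1)) k)ˣ :=
    nonsingInvUnit (oneColMatrix m k) (by rw [det_oneColMatrix]; exact isUnit_one)
  have hM : (ofMatrix M).IsUnital := ofMatrix_isUnital M (oneColMatrix_zero m k)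
  have hd : (ofMatrix M).disc ≠ 0 := by
    rw [disc_ofMatrix]
    have : M.1.det = 1 := det_oneColMatrix m k
    rw [this, one_pow]
    exact one_ne_zero
  -- The degeneration is a map from the affine line: its generic point gives the étale prime `ker
  -- f`, and evaluation at `0` gives `β`.
  obtain ⟨f, hf⟩ := hU.exists_map (degeneration hM) (degeneration_isUnital hM)
  refine ⟨RingHom.ker f, RingHom.ker_isPrime f, fun h => ?_, ?_⟩
  · refine disc_degeneration_ne_zero hM hd ?_
    rw [← hf, map_disc]
    exact h
  · have : β = (Polynomial.aeval (0 : k)).comp f := hU.ext (by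
      rw [hβ, ← degeneration_map_zero hM, ← hf]
      rfl)
    intro x hx
    change β x = 0
    rw [this, AlgHom.comp_apply, show f x = 0 from hx, map_zero]

variable (U) in
/-- The locus of nonvanishing discriminant. -/
def discLocus : Set (PrimeSpectrum A) := {x | U.disc ∉ x.asIdeal}

theorem isOpen_discLocus : IsOpen (discLocus U) :=
  PrimeSpectrum.isOpen_basicOpen (a := U.disc)

theorem IsUniversal.closure_discLocus (hU : IsUniversal k U) {φ : A →ₐ[k] GenRing m k}
    (hφ : U.map φ.toRingHom = ofMatrix (genUnit m k)) :
    closure (discLocus U) = closure {(⟨RingHom.ker φ, RingHom.ker_isPrime φ⟩ : PrimeSpectrum A)} := by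
  apply subset_antisymm
  · refine closure_minimal (fun x hx => ?_) isClosed_closure
    rw [PrimeSpectrum.closure_singleton]
    exact hU.ker_le hφ x.asIdeal hx
  · exact closure_mono (Set.singleton_subset_iff.2 (disc_notMem_ker hφ))

/-- If an irreducible set contains this closure, the open étale locus meets it in the generic point,
hence is dense in it, so the set is no larger. -/
theorem IsUniversal.closure_discLocus_mem_irreducibleComponents (hU : IsUniversal k U)
    {φ : A →ₐ[k] GenRing m k} (hφ : U.map φ.toRingHom = ofMatrix (genUnit m k)) :
    closure (discLocus U) ∈ irreducibleComponents (PrimeSpectrum A) := by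
  let ξ : PrimeSpectrum A := ⟨RingHom.ker φ, RingHom.ker_isPrime φ⟩
  have hξ : ξ ∈ discLocus U := disc_notMem_ker hφ
  refine ⟨?_, fun t ht hle => ?_⟩
  · rw [hU.closure_discLocus hφ]
    exact isIrreducible_singleton.closure
  · refine (subset_closure_inter_of_isPreirreducible_of_isOpen ht.2 isOpen_discLocus
      ⟨ξ, hle (subset_closure hξ), hξ⟩).trans ?_
    exact closure_mono Set.inter_subset_right

theorem IsUniversal.mem_closure_discLocus (hU : IsUniversal k U) {β : A →ₐ[k] k}
    (hβ : U.map β.toRingHom = squareZero (m + 1) k) (x : PrimeSpectrum A)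
    (hx : x.asIdeal = RingHom.ker β) : x ∈ closure (discLocus U) := by
  obtain ⟨p, hp, hd, hle⟩ := hU.exists_le_ker hβ
  have h : x ∈ closure {(⟨p, hp⟩ : PrimeSpectrum A)} := by
    rw [PrimeSpectrum.closure_singleton]
    exact hle.trans hx.ge
  exact closure_mono (Set.singleton_subset_iff.2 hd) h

theorem topologicalKrullDim_zeroLocus (I : Ideal A) :
    topologicalKrullDim (PrimeSpectrum.zeroLocus (I : Set A)) = ringKrullDim (A ⧸ I) := by
  have hs : Function.Surjective (Ideal.Quotient.mk I) := Ideal.Quotient.mk_surjective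
  have hr := range_comap_of_surjective _ _ hs
  rw [Ideal.mk_ker] at hr
  rw [← hr, ← PrimeSpectrum.topologicalKrullDim_eq_ringKrullDim]
  exact (IsHomeomorph.topologicalKrullDim_eq _
    (PrimeSpectrum.isClosedEmbedding_comap_of_surjective _ _ hs).isEmbedding.toHomeomorph.isHomeomorph).symm

end Universal

end ModuliAlg

/-! ### Dimension of the étale component -/

namespace ModuliAlg

open BasedAlg Matrix

section Dimension

/-- Lying over and going up lift chains of primes to `S`; incomparability keeps chains strict when
contracted to `R`. -/
theorem ringKrullDim_eq_of_isIntegral (R S : Type*) [CommRing R] [CommRing S] [Algebra R S]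
    [Algebra.IsIntegral R S] (hinj : Function.Injective (algebraMap R S)) :
    ringKrullDim R = ringKrullDim S := by
  apply le_antisymm
  · refine iSup_le fun l => ?_
    obtain ⟨Q, hQ, hQl⟩ := Ideal.exists_ideal_over_prime_of_isIntegral (S := S) l.head.asIdeal ⊥ (by
      rw [← RingHom.ker_eq_comap_bot, (RingHom.injective_iff_ker_eq_bot _).1 hinj]
      exact bot_le)
    have : Q.LiesOver l.head.asIdeal := ⟨hQl.2.symm⟩
    have := hQl.1
    obtain ⟨l', hl', -⟩ := Ideal.exists_ltSeries_of_hasGoingUp (S := S) l Q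
    rw [← hl']
    exact le_iSup (fun p : LTSeries (PrimeSpectrum S) => (p.length : WithBot ℕ∞)) l'
  · refine Order.krullDim_le_of_strictMono (PrimeSpectrum.comap (algebraMap R S)) fun p q h => ?_
    exact Ideal.IsIntegral.comap_lt_comap h

/-- Noether normalization: the ring is integral over a polynomial ring, with the same dimension and
transcendence degree. -/
theorem ringKrullDim_eq_of_trdeg_eq (k A : Type u) [Field k] [CommRing A] [IsDomain A]
    [Algebra k A] [Algebra.FiniteType k A] {d : ℕ} (h : Algebra.trdeg k A = d) :
    ringKrullDim A = d := by
  obtain ⟨s, g, hg, hint⟩ := exists_integral_inj_algHom_of_fg k A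
  let _ : Algebra (MvPolynomial (Fin s) k) A := g.toRingHom.toAlgebra
  have : IsScalarTower k (MvPolynomial (Fin s) k) A := IsScalarTower.of_algHom g
  have : Algebra.IsIntegral (MvPolynomial (Fin s) k) A := ⟨hint⟩
  have : FaithfulSMul (MvPolynomial (Fin s) k) A := (faithfulSMul_iff_algebraMap_injective _ _).2 hg
  have h1 := trdeg_add_eq k (MvPolynomial (Fin s) k) (A := A)
  have h0 : Algebra.trdeg (MvPolynomial (Fin s) k) A = 0 := trdeg_eq_zero
  rw [h0, add_zero, h, MvPolynomial.trdeg_of_isDomain] at h1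
  have hs : s = d := by simpa using h1
  rw [← ringKrullDim_eq_of_isIntegral (MvPolynomial (Fin s) k) A hg,
    MvPolynomial.ringKrullDim_of_isNoetherianRing, ringKrullDim_eq_zero_of_field, hs]
  simp

/-- Row `i` of the generic matrix is the `i`-th projection to the base, a ring homomorphism. It is
therefore a left eigenvector of multiplication by `e_j` with eigenvalue the `(i, j)` entry, which is
a root of a characteristic polynomial over `A`. -/
theorem isIntegral_genUnit {m : ℕ} {k : Type u} [Field k] {A : Type u} [CommRing A]
    {U : BasedAlg (m + 1) A} [Algebra A (GenRing m k)]
    (hU : U.map (algebraMap A (GenRing m k)) = ofMatrix (genUnit m k)) (i j : Fin (m + 1)) :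
    IsIntegral A ((genUnit m k).1 i j) := by
  let L : Matrix (Fin (m + 1)) (Fin (m + 1)) A := of fun l a => U.c j a l
  refine ⟨L.charpoly, L.charpoly_monic, ?_⟩
  rw [← Polynomial.eval_map, ← Matrix.charpoly_map, Matrix.eval_charpoly,
    ← Matrix.exists_vecMul_eq_zero_iff]
  -- The eigenvector is nonzero because its first entry is `1`.
  refine ⟨(genUnit m k).1 i, fun h => ?_, ?_⟩
  · have := congrFun h 0
    rw [genUnit_zero m k i 0 rfl] at this
    exact one_ne_zero this
  · ext a
    have h2 : (genUnit m k).1 *ᵥ (ofMatrix (genUnit m k)).c j a =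
        (genUnit m k).1.col j * (genUnit m k).1.col a := by
      rw [← mul_single, mul_ofMatrix, mulVec_mulVec, Units.mul_inv, one_mulVec,
        mulVec_single_one, mulVec_single_one]
    have h3 := congrFun h2 i
    rw [← hU] at h3
    rw [vecMul_sub]
    simp only [mulVec, dotProduct, Pi.mul_apply, col_apply] at h3
    simpa [vecMul, dotProduct, Matrix.scalar_apply, L, sub_eq_zero, map_c] using h3.symm

/-- `GenRing m k` is algebraic both over `A` and over the polynomial ring in the `(m + 1) * m` free
matrix entries, so all three have the same transcendence degree. -/
theorem trdeg_eq_of_genUnit {m : ℕ} {k : Type u} [Field k] {A : Type u} [CommRing A]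
    [Algebra k A] {U : BasedAlg (m + 1) A} [Algebra A (GenRing m k)]
    [IsScalarTower k A (GenRing m k)] [FaithfulSMul A (GenRing m k)]
    (hU : U.map (algebraMap A (GenRing m k)) = ofMatrix (genUnit m k)) :
    Algebra.trdeg k A = ((m + 1) * m : ℕ) := by
  have hAdom : IsDomain A := (FaithfulSMul.algebraMap_injective A (GenRing m k)).isDomain
  let P := MvPolynomial (Fin (m + 1) × Fin m) k
  have hinj : Function.Injective (algebraMap P (GenRing m k)) :=
    IsLocalization.injective _ (powers_det_le m k)
  have : FaithfulSMul P (GenRing m k) := (faithfulSMul_iff_algebraMap_injective _ _).2 hinj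
  have : Algebra.IsAlgebraic P (GenRing m k) :=
    IsLocalization.isAlgebraic _ (Submonoid.powers (genMatrix m k).det)
  have hP (x : P) : IsIntegral A (algebraMap P (GenRing m k) x) := by
    induction x using MvPolynomial.induction_on with
    | C r =>
      have : algebraMap P (GenRing m k) (MvPolynomial.C r) =
          algebraMap A (GenRing m k) (algebraMap k A r) := by
        rw [← IsScalarTower.algebraMap_apply, IsScalarTower.algebraMap_apply k P]
        rfl
      rw [this]
      exact isIntegral_algebraMap
    | add p q hp hq => rw [map_add]; exact hp.add hq
    | mul_X p s hp =>
      rw [_root_.map_mul, ← genUnit_succ]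
      exact hp.mul (isIntegral_genUnit hU _ _)
  have : Algebra.IsAlgebraic A (GenRing m k) := by
    refine ⟨fun x => ?_⟩
    obtain ⟨⟨p, s⟩, hps⟩ := IsLocalization.surj (Submonoid.powers (genMatrix m k).det) x
    have hs : algebraMap P (GenRing m k) s ∈ nonZeroDivisors (GenRing m k) := by
      rw [mem_nonZeroDivisors_iff_ne_zero, Ne, map_eq_zero_iff _ hinj]
      exact nonZeroDivisors.ne_zero (powers_det_le m k s.2)
    refine IsAlgebraic.of_mul hs (hP s).isAlgebraic ?_
    rw [_root_.mul_comm, hps]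
    exact (hP p).isAlgebraic
  have h1 := trdeg_add_eq k P (A := GenRing m k)
  have h2 := trdeg_add_eq k A (A := GenRing m k)
  have h3 : Algebra.trdeg P (GenRing m k) = 0 := trdeg_eq_zero
  have h4 : Algebra.trdeg A (GenRing m k) = 0 := trdeg_eq_zero
  rw [h3, add_zero] at h1
  rw [h4, add_zero] at h2
  rw [h2, ← h1, MvPolynomial.trdeg_of_isDomain]
  simp

theorem ringKrullDim_quotient_ker {m : ℕ} {k : Type u} [Field k] {A : Type u} [CommRing A]
    [Algebra k A] [Algebra.FiniteType k A] {U : BasedAlg (m + 1) A} {φ : A →ₐ[k] GenRing m k}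
    (hφ : U.map φ.toRingHom = ofMatrix (genUnit m k)) :
    ringKrullDim (A ⧸ RingHom.ker φ) = ((m + 1) * m : ℕ) := by
  let ψ : A ⧸ RingHom.ker φ →ₐ[k] GenRing m k := Ideal.kerLiftAlg φ
  have hψ : Function.Injective ψ := Ideal.kerLiftAlg_injective φ
  let _ : Algebra (A ⧸ RingHom.ker φ) (GenRing m k) := ψ.toRingHom.toAlgebra
  have : IsScalarTower k (A ⧸ RingHom.ker φ) (GenRing m k) := IsScalarTower.of_algHom ψ
  have : FaithfulSMul (A ⧸ RingHom.ker φ) (GenRing m k) :=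
    (faithfulSMul_iff_algebraMap_injective _ _).2 hψ
  have : IsDomain (A ⧸ RingHom.ker φ) := hψ.isDomain ψ.toRingHom
  refine ringKrullDim_eq_of_trdeg_eq k _
    (trdeg_eq_of_genUnit (U := U.map (Ideal.Quotient.mk (RingHom.ker φ))) ?_)
  rw [← hφ]
  rfl

end Dimension

end ModuliAlg

/-! ### Conclusion -/

namespace ModuliAlg

open BasedAlg Matrix

theorem IsUniversal.topologicalKrullDim_closure_discLocus {m : ℕ} {k : Type u} [Field k]
    {A : Type u} [CommRing A] [Algebra k A] [Algebra.FiniteType k A] {U : BasedAlg (m + 1) A}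
    (hU : IsUniversal k U) {φ : A →ₐ[k] GenRing m k}
    (hφ : U.map φ.toRingHom = ofMatrix (genUnit m k)) :
    topologicalKrullDim (closure (discLocus U)) = ((m + 1) * m : ℕ) := by
  rw [hU.closure_discLocus hφ, PrimeSpectrum.closure_singleton, topologicalKrullDim_zeroLocus]
  exact ringKrullDim_quotient_ker hφ

theorem etaleLocus_eq_discLocus (m : ℕ) (k : Type u) [Field k] :
    etaleLocus (m + 1) k = discLocus (univ1k (m + 1) k) := by
  have h : (univ1k (m + 1) k).disc =
      (1 : k) ⊗ₜ[ℤ] restrict1 (m + 1) (univ (m + 1)).disc := by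
    rw [univ1k, map_disc, univ1, map_disc]
    rfl
  rw [discLocus, h]
  rfl

theorem mul_pred_lt {n : ℕ} (hn : 4 ≤ n) : n * (n - 1) < n * (n - 1) ^ 2 / 2 := by
  obtain ⟨m, rfl⟩ : ∃ m, n = m + 4 := ⟨n - 4, by omega⟩
  rw [show m + 4 - 1 = m + 3 from rfl, ← Nat.add_one_le_iff, Nat.le_div_iff_mul_le (by norm_num)]
  nlinarith

theorem closure_etaleLocus {m : ℕ} (k : Type u) [Field k] :
    closure (etaleLocus (m + 1) k) ∈ irreducibleComponents (B1k (m + 1) k) ∧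
    bullet (m + 1) k ∈ closure (etaleLocus (m + 1) k) ∧
    topologicalKrullDim (closure (etaleLocus (m + 1) k)) = ((m + 1) * m : ℕ) := by
  rw [etaleLocus_eq_discLocus]
  have hU := univ1k_isUniversal (m + 1) k
  obtain ⟨φ, hφ⟩ := hU.exists_map (ofMatrix (genUnit m k)) (ofMatrix_isUnital _ (genUnit_zero m k))
  exact ⟨hU.closure_discLocus_mem_irreducibleComponents hφ,
    hU.mem_closure_discLocus (univ1k_map_bulletHom _ k) _ (bullet_asIdeal _ k),
    hU.topologicalKrullDim_closure_discLocus hφ⟩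

end ModuliAlg

theorem mainTheorem6 (k : Type u) [Field k] :
    (∀ n : ℕ, List.TFAE
      [n ≤ 3, Smooth (ModuliAlg.B1kStr n k), Smooth (ModuliAlg.BkStr n k)]) ∧
    (Nonempty (ModuliAlg.B1 0 ≅ AffineSpace (Fin 0) (Spec (.of ℤ))) ∧
      Nonempty (ModuliAlg.B1 1 ≅ AffineSpace (Fin 0) (Spec (.of ℤ))) ∧
      Nonempty (ModuliAlg.B1 2 ≅ AffineSpace (Fin 2) (Spec (.of ℤ))) ∧
      Nonempty (ModuliAlg.B1 3 ≅ AffineSpace (Fin 6) (Spec (.of ℤ)))) ∧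
    (∀ n : ℕ, 4 ≤ n →
      Module.finrank
          (IsLocalRing.ResidueField
            ((ModuliAlg.B1k n k).presheaf.stalk (ModuliAlg.bullet n k)))
          (ModuliAlg.TangentSpace (ModuliAlg.B1k n k) (ModuliAlg.bullet n k)) =
        n * (n - 1) ^ 2 / 2 ∧
      closure (ModuliAlg.etaleLocus n k) ∈ irreducibleComponents (ModuliAlg.B1k n k) ∧
      ModuliAlg.bullet n k ∈ closure (ModuliAlg.etaleLocus n k) ∧
      topologicalKrullDim (closure (ModuliAlg.etaleLocus n k)) = ((n * (n - 1) : ℕ) : ℕ∞) ∧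
      n * (n - 1) < n * (n - 1) ^ 2 / 2) := by
  refine ⟨fun n => ModuliAlg.smooth_tfae n k,
    ⟨⟨ModuliAlg.B1IsoAffineSpace ModuliAlg.coordRing1Zero⟩,
      ⟨ModuliAlg.B1IsoAffineSpace ModuliAlg.coordRing1One⟩,
      ⟨ModuliAlg.B1IsoAffineSpace ModuliAlg.coordRing1Two⟩,
      ⟨ModuliAlg.B1IsoAffineSpace ModuliAlg.coordRing1Three⟩⟩, fun n hn => ?_⟩
  refine ⟨ModuliAlg.finrank_tangentSpace_bullet n k (by omega), ?_⟩
  obtain ⟨m, rfl⟩ : ∃ m, n = m + 1 := ⟨n - 1, by omega⟩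
  obtain ⟨h1, h2, h3⟩ := ModuliAlg.closure_etaleLocus (m := m) k
  exact ⟨h1, h2, h3, ModuliAlg.mul_pred_lt hn⟩
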